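/- Let $M$ be a complex manifold (Hausdorff, second countable, of finite dimension), and let $\mathcal U=\{U_0,U_1\}$ be an open covering of $M$ by two sets, $U_{01}=U_0\cap U_1$. (a) Let $(\mathcal K^\bullet,d_{\mathcal K})$, $\mathcal K^\bullet=(\mathcal K^r)_{r\in\mathbb Z}$, be a complex of sheaves of $C^\infty$ differential forms on $M$; more generally, let each $\mathcal K^r$ be a sheaf of complex vector spaces which is also a module, by complex-linear actions, over the sheaf of real-valued $C^\infty$ functions, and let $d_{\mathcal K}:\mathcal K^r\to\mathcal K^{r+1}$ be $\mathbb C$-linear sheaf morphisms with $d_{\mathcal K}\circ d_{\mathcal K}=0$. Put $$\mathcal K^r(\mathcal U)=\mathcal K^r(U_0)\oplus\mathcal K^r(U_1)\oplus\mathcal K^{r-1}(U_{01}),\qquad D_{\mathcal K}(\sigma_0,\sigma_1,\sigma_{01})=(d_{\mathcal K}\sigma_0,\ d_{\mathcal K}\sigma_1,\ \sigma_1-\sigma_0-d_{\mathcal K}\sigma_{01}).$$ Let $H^r_{d_{\mathcal K}}(M)$ and $H^r_{D_{\mathcal K}}(\mathcal U)$ be the $r$-th cohomology (kernel modulo image)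 of $(\mathcal K^\bullet(M),d_{\mathcal K})$ and of $(\mathcal K^\bullet(\mathcal U),D_{\mathcal K})$. Then for every $r$ the map $\mathcal K^r(M)\to\mathcal K^r(\mathcal U)$, $\omega\mapsto(\omega,\omega,0)$ (with restrictions understood), is compatible with the differentials and induces an isomorphism $H^r_{d_{\mathcal K}}(M)\cong H^r_{D_{\mathcal K}}(\mathcal U)$. (b) Let $\mathcal E^{p,q}$ be the sheaf of $C^\infty$ complex-valued $(p,q)$-forms on $M$ (zero if $p<0$ or $q<0$), and $\mathcal E^{(p,q)+1}=\mathcal E^{p+1,q}\oplus\mathcal E^{p,q+1}$. Consider the complex $$\cdots\to\mathcal E^{(p-2,q-2)+1}\xrightarrow{\bar\partial+\partial}\mathcal E^{p-1,q-1}\xrightarrow{\bar\partial\partial}\mathcal E^{p,q}\xrightarrow{d}\mathcal E^{(p,q)+1}\xrightarrow{\bar\partial+\partial}\mathcal E^{p+1,q+1}\xrightarrow{\bar\partial\partial}\cdots,$$ where $d\eta=(\partial\eta,\bar\partial\eta)$ and $(\bar\partial+\partial)(\eta^{(1)},\eta^{(2)})=\bar\partial\eta^{(1)}+\partial\eta^{(2)}$.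 For all integers $p,q$, the map $\omega\mapsto(\omega,\omega,0)$ is compatible with the differentials and induces an isomorphism from the Bott-Chern cohomology $$H^{p,q}_{\rm BC}(M)=\ker\bigl(d:\mathcal E^{p,q}(M)\to\mathcal E^{(p,q)+1}(M)\bigr)\big/\bar\partial\partial\,\mathcal E^{p-1,q-1}(M)$$ onto the Čech-Bott-Chern cohomology, which is the quotient of $$\{\sigma\in\mathcal E^{p,q}(U_0)\oplus\mathcal E^{p,q}(U_1)\oplus\mathcal E^{p-1,q-1}(U_{01})\mid d\sigma_0=d\sigma_1=0,\ \sigma_1-\sigma_0-\bar\partial\partial\sigma_{01}=0\}$$ by the space of all $(\bar\partial\partial\tau_0,\ \bar\partial\partial\tau_1,\ \tau_1-\tau_0-\bar\partial\tau_{01}^{(1)}-\partial\tau_{01}^{(2)})$ with $\tau_i\in\mathcal E^{p-1,q-1}(U_i)$ and $(\tau_{01}^{(1)},\tau_{01}^{(2)})\in\mathcal E^{(p-2,q-2)+1}(U_{01})$. (c) In the same notation, for all integers $p,q$, the map $\omega\mapsto(\omega,\omega,0)$ is compatible with the differentials and induces an isomorphism from the Aeppli cohomology $$H^{p,q}_{\rm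 A}(M)=\ker\bigl(\bar\partial\partial:\mathcal E^{p,q}(M)\to\mathcal E^{p+1,q+1}(M)\bigr)\big/\bigl(\bar\partial\mathcal E^{p,q-1}(M)+\partial\mathcal E^{p-1,q}(M)\bigr)$$ onto the Čech-Aeppli cohomology, which is the quotient of $$\{\xi\in\mathcal E^{p,q}(U_0)\oplus\mathcal E^{p,q}(U_1)\oplus\mathcal E^{(p-1,q-1)+1}(U_{01})\mid \bar\partial\partial\xi_0=\bar\partial\partial\xi_1=0,\ \xi_1-\xi_0-\bar\partial\xi_{01}^{(1)}-\partial\xi_{01}^{(2)}=0\}$$ by the space of all elements with components $\xi_i=\bar\partial\eta_i^{(1)}+\partial\eta_i^{(2)}$ and $\xi_{01}^{(k)}=\eta_1^{(k)}-\eta_0^{(k)}-(d\eta_{01})^{(k)}$, where $d\eta_{01}=(\partial\eta_{01},\bar\partial\eta_{01})$, $(\eta_i^{(1)},\eta_i^{(2)})\in\mathcal E^{(p-1,q-1)+1}(U_i)$ and $\eta_{01}\in\mathcal E^{p-1,q-1}(U_{01})$. -/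

import Mathlib

open CategoryTheory TopologicalSpace Opposite
open scoped Manifold ContDiff Topology

universe u

noncomputable section

namespace CechForms

section Euclidean

variable {E : Type} [NormedAddCommGroup E] [NormedSpace ℂ E]

/-- Multiplication by `i` on a complex vector space, as a real-linear map. -/
def mulI (E : Type) [NormedAddCommGroup E] [NormedSpace ℂ E] : E →L[ℝ] E :=
  Complex.I • ContinuousLinearMap.id ℝ E

/-- For `ε = -i` this is the complex-linear part `v ↦ (L v - i L (i v)) / 2` of a real-linear map
`L` into a complex vector space of alternating forms; for `ε = i` it is the conjugate-linear
part `v ↦ (L v + i L (i v)) / 2`. -/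
def partOf (ε : ℂ) {r : ℕ} (L : E →L[ℝ] (E [⋀^Fin r]→L[ℝ] ℂ)) : E →L[ℝ] (E [⋀^Fin r]→L[ℝ] ℂ) :=
  (1 / 2 : ℂ) • (L + ε • (L.comp (mulI E)))

/-- For `ε = -i` this is `∂F`, for `ε = i` it is `∂̄F`, where `F` is a complex valued differential
`r`-form on (an open subset of) the complex vector space `E`: the derivative of `F` is replaced by
its complex-linear, respectively conjugate-linear, part and then antisymmetrised, just as the
exterior derivative is the antisymmetrisation of the whole derivative. In coordinates,
`∂ (f dz_I ∧ dz̄_J) = ∑ k, ∂f/∂z_k dz_k ∧ dz_I ∧ dz̄_J`, and similarly for `∂̄`. -/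
def dPart (ε : ℂ) {r : ℕ} (F : E → E [⋀^Fin r]→L[ℝ] ℂ) (y : E) : E [⋀^Fin (r + 1)]→L[ℝ] ℂ :=
  ContinuousAlternatingMap.alternatizeUncurryFin (partOf ε (fderiv ℝ F y))

/-- `∂ + ∂̄ = d`, with Mathlib's exterior derivative. -/
theorem dPart_add_dPart {r : ℕ} (F : E → E [⋀^Fin r]→L[ℝ] ℂ) (y : E) :
    dPart (-Complex.I) F y + dPart Complex.I F y = extDeriv F y := by
  rw [dPart, dPart, extDeriv, ← ContinuousAlternatingMap.alternatizeUncurryFin_add]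
  congr 1
  ext v w
  simp [partOf]
  ring

/-- `partOf` as a continuous real-linear map. -/
def partCLM (ε : ℂ) (r : ℕ) :
    (E →L[ℝ] (E [⋀^Fin r]→L[ℝ] ℂ)) →L[ℝ] (E →L[ℝ] (E [⋀^Fin r]→L[ℝ] ℂ)) :=
  (1 / 2 : ℂ) • (ContinuousLinearMap.id ℝ _ +
    ε • ((ContinuousLinearMap.compL ℝ E E (E [⋀^Fin r]→L[ℝ] ℂ)).flip (mulI E)))

theorem partCLM_apply (ε : ℂ) {r : ℕ} (L : E →L[ℝ] (E [⋀^Fin r]→L[ℝ] ℂ)) :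
    partCLM ε r L = partOf ε L := rfl

theorem dPart_eq (ε : ℂ) {r : ℕ} (F : E → E [⋀^Fin r]→L[ℝ] ℂ) (y : E) :
    dPart ε F y = ((ContinuousAlternatingMap.alternatizeUncurryFinCLM ℝ E ℂ).comp
      (partCLM ε r)) (fderiv ℝ F y) := rfl

theorem dPart_congr (ε : ℂ) {r : ℕ} {F G : E → E [⋀^Fin r]→L[ℝ] ℂ} {y : E} (h : F =ᶠ[𝓝 y] G) :
    dPart ε F y = dPart ε G y := by
  rw [dPart, dPart, h.fderiv_eq]

theorem dPart_add (ε : ℂ) {r : ℕ} {F G : E → E [⋀^Fin r]→L[ℝ] ℂ} {y : E}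
    (hF : DifferentiableAt ℝ F y) (hG : DifferentiableAt ℝ G y) :
    dPart ε (fun z ↦ F z + G z) y = dPart ε F y + dPart ε G y := by
  rw [dPart_eq, dPart_eq, dPart_eq, fderiv_fun_add hF hG, map_add]

theorem partOf_smul (ε c : ℂ) {r : ℕ} (L : E →L[ℝ] (E [⋀^Fin r]→L[ℝ] ℂ)) :
    partOf ε (c • L) = c • partOf ε L := by
  ext v w
  simp [partOf]
  ring

theorem dPart_smul (ε c : ℂ) {r : ℕ} {F : E → E [⋀^Fin r]→L[ℝ] ℂ} {y : E}
    (hF : DifferentiableAt ℝ F y) :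
    dPart ε (fun z ↦ c • F z) y = c • dPart ε F y := by
  rw [dPart, dPart, fderiv_fun_const_smul hF, partOf_smul,
    ContinuousAlternatingMap.alternatizeUncurryFin_smul]

theorem contDiffOn_dPart (ε : ℂ) {r : ℕ} {F : E → E [⋀^Fin r]→L[ℝ] ℂ} {s : Set E}
    (hs : IsOpen s) (hF : ContDiffOn ℝ ∞ F s) : ContDiffOn ℝ ∞ (dPart ε F) s := by
  have h1 : ContDiffOn ℝ ∞ (fderiv ℝ F) s := hF.fderiv_of_isOpen hs (by simp)
  exact ((ContinuousAlternatingMap.alternatizeUncurryFinCLM ℝ E ℂ).comp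
      (partCLM ε r)).contDiff.comp_contDiffOn h1

/-- `∂` and `∂̄` commute with the pullback by a map which is holomorphic near `y`. -/
theorem dPart_pullback (ε : ℂ) {r : ℕ} {F : E → E [⋀^Fin r]→L[ℝ] ℂ} {τ : E → E} {y : E}
    (hF : DifferentiableAt ℝ F (τ y)) (hτ : ContDiffAt ℂ 2 τ y) :
    dPart ε (fun z ↦ (F (τ z)).compContinuousLinearMap (fderiv ℝ τ z)) y =
      (dPart ε F (τ y)).compContinuousLinearMap (fderiv ℝ τ y) := by
  have hτR : ContDiffAt ℝ 2 τ y := hτ.restrict_scalars ℝ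
  have hev : ∀ᶠ z in 𝓝 y, DifferentiableAt ℂ τ z := by
    filter_upwards [hτ.eventually (by simp)] with z hz using hz.differentiableAt (by simp)
  have hJ : ∀ᶠ z in 𝓝 y, ∀ w, fderiv ℝ τ z (Complex.I • w) = Complex.I • fderiv ℝ τ z w := by
    filter_upwards [hev] with z hz w
    rw [hz.fderiv_restrictScalars ℝ]
    simp
  have hd1 : DifferentiableAt ℝ τ y := hτR.differentiableAt (by simp)
  have hd2 : DifferentiableAt ℝ (fderiv ℝ τ) y :=
    (hτR.fderiv_right (m := 1) (by norm_num)).differentiableAt (by simp)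
  have hsymm : ∀ v w, fderiv ℝ (fderiv ℝ τ) y v w = fderiv ℝ (fderiv ℝ τ) y w v :=
    hτR.isSymmSndFDerivAt (by simp)
  have hI : ∀ v w, fderiv ℝ (fderiv ℝ τ) y v (Complex.I • w) =
      Complex.I • fderiv ℝ (fderiv ℝ τ) y v w := by
    intro v w
    have e1 : HasFDerivAt (fun z ↦ fderiv ℝ τ z (Complex.I • w))
        ((fderiv ℝ (fderiv ℝ τ) y).flip (Complex.I • w)) y := by
      simpa using hd2.hasFDerivAt.clm_apply (hasFDerivAt_const (Complex.I • w) y)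
    have e2 : HasFDerivAt (fun z ↦ Complex.I • fderiv ℝ τ z w)
        (Complex.I • (fderiv ℝ (fderiv ℝ τ) y).flip w) y := by
      simpa using (hd2.hasFDerivAt.clm_apply (hasFDerivAt_const w y)).fun_const_smul Complex.I
    have e3 := e1.congr_of_eventuallyEq (f₁ := fun z ↦ Complex.I • fderiv ℝ τ z w)
      (hJ.mono fun z hz ↦ (hz w).symm)
    simpa using congrArg (fun L ↦ L v) (e3.unique e2)
  have hh : fderiv ℝ (fun z ↦ (F (τ z)).compContinuousLinearMap (fderiv ℝ τ z)) y =
      (ContinuousAlternatingMap.compContinuousLinearMapCLM (fderiv ℝ τ y)).comp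
        ((fderiv ℝ F (τ y)).comp (fderiv ℝ τ y)) +
      ((F (τ y)).fderivCompContinuousLinearMap (fderiv ℝ τ y)).comp (fderiv ℝ (fderiv ℝ τ) y) :=
    ((hF.hasFDerivAt.comp y hd1.hasFDerivAt).continuousAlternatingMapCompContinuousLinearMap
      hd2.hasFDerivAt).fderiv
  set h := fderiv ℝ (fderiv ℝ τ) y with hh_def
  set A := (F (τ y)).fderivCompContinuousLinearMap (fderiv ℝ τ y) with hA
  have z1 : ContinuousAlternatingMap.alternatizeUncurryFin (A.comp h) = 0 :=
    ContinuousAlternatingMap.alternatizeUncurryFin_fderivCompContinuousLinearMap_eq_zero _ _ hsymm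
  have z2 : ContinuousAlternatingMap.alternatizeUncurryFin (A.comp (h.comp (mulI E))) = 0 := by
    apply ContinuousAlternatingMap.alternatizeUncurryFin_fderivCompContinuousLinearMap_eq_zero
    intro v w
    have : ∀ v w, h (Complex.I • v) w = Complex.I • h v w := fun v w ↦ by
      rw [hsymm, hI, hsymm]
    simp [mulI, this, hsymm v w]
  have hsplit : partOf ε ((ContinuousAlternatingMap.compContinuousLinearMapCLM (fderiv ℝ τ y)).comp
        ((fderiv ℝ F (τ y)).comp (fderiv ℝ τ y)) + A.comp h) =
      (ContinuousAlternatingMap.compContinuousLinearMapCLM (fderiv ℝ τ y)).comp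
        ((partOf ε (fderiv ℝ F (τ y))).comp (fderiv ℝ τ y)) +
      ((1 / 2 : ℂ) • A.comp h + (1 / 2 : ℂ) • ε • A.comp (h.comp (mulI E))) := by
    ext v w
    simp [partOf, mulI, hJ.self_of_nhds]
    ring
  rw [dPart, hh, hsplit]
  simp only [ContinuousAlternatingMap.alternatizeUncurryFin_add,
    ContinuousAlternatingMap.alternatizeUncurryFin_smul, z1, z2, smul_zero, add_zero]
  ext v
  simp +unfoldPartialApp [dPart, ContinuousAlternatingMap.alternatizeUncurryFin_apply,
    Fin.removeNth, Function.comp_def]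

/-- The homogeneity `α (c v₁, …, c v_r) = c ^ p * c̄ ^ q * α (v₁, …, v_r)` for all nonzero complex
numbers `c`. For `p + q = r` it holds exactly when `α` is of type `(p, q)`, that is, a combination
of the forms `dz_I ∧ dz̄_J` with `|I| = p` and `|J| = q`. -/
def Homog (p q : ℤ) {r : ℕ} (α : E [⋀^Fin r]→L[ℝ] ℂ) : Prop :=
  ∀ c : ℂ, c ≠ 0 → ∀ v : Fin r → E,
    α (fun i ↦ c • v i) = c ^ p * (starRingEnd ℂ c) ^ q * α v

theorem homog_fderiv {p q : ℤ} {r : ℕ} {F : E → E [⋀^Fin r]→L[ℝ] ℂ} {y : E}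
    (hF : DifferentiableAt ℝ F y) (h : ∀ᶠ z in 𝓝 y, Homog p q (F z)) (v : E) :
    Homog p q (fderiv ℝ F y v) := by
  intro c hc w
  have e (w : Fin r → E) : HasFDerivAt (fun z ↦ F z w)
      ((ContinuousAlternatingMap.apply ℝ E ℂ w).comp (fderiv ℝ F y)) y :=
    (ContinuousAlternatingMap.apply ℝ E ℂ w).hasFDerivAt.comp y hF.hasFDerivAt
  have e1 := e (fun i ↦ c • w i)
  have e2 := (e w).const_mul (c ^ p * (starRingEnd ℂ c) ^ q)
  have e3 := e1.congr_of_eventuallyEq (f₁ := fun z ↦ c ^ p * (starRingEnd ℂ c) ^ q * F z w)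
    (h.mono fun z hz ↦ (hz c hc w).symm)
  simpa using congrArg (fun L ↦ L v) (e3.unique e2)

theorem homog_alternatize {p' q' : ℤ} {r : ℕ} {L : E →L[ℝ] (E [⋀^Fin r]→L[ℝ] ℂ)}
    (hL : ∀ (c : ℂ), c ≠ 0 → ∀ v w, L (c • v) (fun i ↦ c • w i) =
      c ^ p' * (starRingEnd ℂ c) ^ q' * L v w) :
    Homog p' q' (ContinuousAlternatingMap.alternatizeUncurryFin L) := by
  intro c hc v
  simp only [ContinuousAlternatingMap.alternatizeUncurryFin_apply, Finset.mul_sum]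
  refine Finset.sum_congr rfl fun i _ ↦ ?_
  have := hL c hc (v i) (i.removeNth v)
  rw [show (i.removeNth fun j ↦ c • v j) = fun j ↦ c • i.removeNth v j from rfl, this]
  simp only [zsmul_eq_mul]
  ring

theorem smul_eq_re_im (c : ℂ) (v : E) : c • v = c.re • v + c.im • (Complex.I • v) := by
  conv_lhs => rw [← Complex.re_add_im c, add_smul, mul_smul, Complex.coe_smul, Complex.coe_smul]

theorem partOf_apply (ε : ℂ) {r : ℕ} (L : E →L[ℝ] (E [⋀^Fin r]→L[ℝ] ℂ)) (v : E) (w : Fin r → E) :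
    partOf ε L v w = (1 / 2) * (L v w + ε * L (Complex.I • v) w) := rfl

theorem partOf_I_smul_apply (ε : ℂ) (hε : ε * ε = -1) {r : ℕ}
    (L : E →L[ℝ] (E [⋀^Fin r]→L[ℝ] ℂ)) (c : ℂ) (v : E) (w : Fin r → E) :
    partOf ε L (c • v) w = (c.re - ε * c.im) * partOf ε L v w := by
  have h2 : Complex.I • c • v = c.re • (Complex.I • v) - c.im • v := by
    rw [smul_eq_re_im c v, smul_add, smul_comm Complex.I c.re, smul_comm Complex.I c.im,
      smul_smul Complex.I, Complex.I_mul_I, neg_one_smul, smul_neg, sub_eq_add_neg]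
  rw [partOf_apply, partOf_apply, h2, smul_eq_re_im c v]
  simp only [map_add, map_sub, map_smul, ContinuousAlternatingMap.add_apply,
    ContinuousAlternatingMap.sub_apply, ContinuousAlternatingMap.smul_apply, Complex.real_smul]
  linear_combination (1 / 2 * c.im * L (Complex.I • v) w) * hε

theorem homog_del {p q : ℤ} {r : ℕ} {F : E → E [⋀^Fin r]→L[ℝ] ℂ} {y : E}
    (hF : DifferentiableAt ℝ F y) (h : ∀ᶠ z in 𝓝 y, Homog p q (F z)) :
    Homog (p + 1) q (dPart (-Complex.I) F y) := by
  refine homog_alternatize fun c hc v w ↦ ?_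
  have h0 := homog_fderiv hF h
  have h1 : Homog p q (partOf (-Complex.I) (fderiv ℝ F y) v) := by
    intro c hc w
    simp only [partOf, smul_apply, add_apply,
      ContinuousLinearMap.comp_apply, ContinuousAlternatingMap.smul_apply,
      ContinuousAlternatingMap.add_apply, h0 _ c hc w, smul_eq_mul]
    ring
  rw [partOf_I_smul_apply _ (by simp), h1 c hc w, zpow_add₀ hc, zpow_one]
  have : (c.re - -Complex.I * c.im : ℂ) = c := by
    conv_rhs => rw [← Complex.re_add_im c]
    ring
  rw [this]
  ring

theorem homog_delbar {p q : ℤ} {r : ℕ} {F : E → E [⋀^Fin r]→L[ℝ] ℂ} {y : E}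
    (hF : DifferentiableAt ℝ F y) (h : ∀ᶠ z in 𝓝 y, Homog p q (F z)) :
    Homog p (q + 1) (dPart Complex.I F y) := by
  refine homog_alternatize fun c hc v w ↦ ?_
  have h0 := homog_fderiv hF h
  have h1 : Homog p q (partOf Complex.I (fderiv ℝ F y) v) := by
    intro c hc w
    simp only [partOf, smul_apply, add_apply,
      ContinuousLinearMap.comp_apply, ContinuousAlternatingMap.smul_apply,
      ContinuousAlternatingMap.add_apply, h0 _ c hc w, smul_eq_mul]
    ring
  rw [partOf_I_smul_apply _ (by simp), h1 c hc w,
    zpow_add₀ (a := starRingEnd ℂ c) (by simpa using hc), zpow_one]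
  have : (c.re - Complex.I * c.im : ℂ) = starRingEnd ℂ c := by
    apply Complex.ext <;> simp
  rw [this]
  ring

end Euclidean

section Manifold

variable {E : Type} [NormedAddCommGroup E] [NormedSpace ℂ E]
  {M : Type u} [TopologicalSpace M] [ChartedSpace E M]

variable (E) in
/-- The space of families, one for each degree `r`, of complex valued alternating real-multilinear
`r`-forms on the real tangent space of `M` at `x`. A homogeneous form of degree `r` is a family
supported in degree `r`. -/
abbrev Fibre (x : M) : Type :=
  ∀ r : ℕ, (TangentSpace 𝓘(ℝ, E) x) [⋀^Fin r]→L[ℝ] ℂ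

/-- The degree `r` component of `η` in the coordinates of the chart at `c`: its pullback by the
inverse of that chart. -/
def chartRep (c : M) (η : ∀ x : M, Fibre E x) (r : ℕ) (y : E) : E [⋀^Fin r]→L[ℝ] ℂ :=
  (η ((chartAt E c).symm y) r).compContinuousLinearMap
    (mfderiv 𝓘(ℝ, E) 𝓘(ℝ, E) (chartAt E c).symm y)

open scoped Classical in
/-- Extension of a form on `U` by zero (only its values on `U` matter below). -/
def extendZero {U : Opens M} (η : ∀ x : U, Fibre E (x : M)) (x : M) : Fibre E x :=
  if h : x ∈ U then η ⟨x, h⟩ else 0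

variable (E) in
/-- The open subset of the model space which corresponds to `U` in the chart at `c`. -/
def chartDom (c : M) (U : Opens M) : Set E :=
  (chartAt E c).target ∩ (chartAt E c).symm ⁻¹' U

set_option linter.unusedSectionVars false in
theorem isOpen_chartDom (c : M) (U : Opens M) : IsOpen (chartDom E c U) :=
  (chartAt E c).isOpen_inter_preimage_symm U.isOpen

/-- The form `α` at `x` is homogeneous of degree `p + q` and of type `(p, q)`. For `p < 0` or `q < 0`
this forces `α = 0`. -/
def IsType (p q : ℤ) (x : M) (α : Fibre E x) : Prop :=
  ∀ r : ℕ, ((r : ℤ) ≠ p + q → α r = 0) ∧ Homog (E := E) p q (α r)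

/-- The coordinate change from the chart at `c` to the chart at `c'`. -/
def coordChange (c c' : M) : E → E := chartAt E c' ∘ (chartAt E c).symm

theorem contDiffAt_coordChange [IsManifold 𝓘(ℂ, E) ω M] {c c' : M} {y : E}
    (hy : y ∈ (chartAt E c).target) (hy' : (chartAt E c).symm y ∈ (chartAt E c').source) :
    ContDiffAt ℂ ω (coordChange c c' : E → E) y := by
  have h := 𝓘(ℂ, E).contDiffOn_extendCoordChange (n := ω)
    (IsManifold.chart_mem_maximalAtlas c) (IsManifold.chart_mem_maximalAtlas (M := M) c')
  refine (ContDiffOn.congr ?_ fun _ _ ↦ rfl).contDiffAt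
    (((chartAt E c).isOpen_inter_preimage_symm (chartAt E c').open_source).mem_nhds ⟨hy, hy'⟩)
  convert! h using 1
  ext z; simp [ModelWithCorners.extendCoordChange]

theorem mfderiv_symm_eq [IsManifold 𝓘(ℂ, E) ω M] {c : M} {y : E}
    (hy : y ∈ (chartAt E c).target) :
    (mfderiv 𝓘(ℝ, E) 𝓘(ℝ, E) (chartAt E c).symm y : E →L[ℝ] E) =
      fderiv ℝ (coordChange c ((chartAt E c).symm y)) y := by
  have hd : DifferentiableAt ℝ (coordChange c ((chartAt E c).symm y) : E → E) y :=
    ((contDiffAt_coordChange hy (mem_chart_source E _)).restrict_scalars ℝ).differentiableAt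
      (by simp)
  have hm : MDifferentiableAt 𝓘(ℝ, E) 𝓘(ℝ, E) (chartAt E c).symm y := by
    refine ⟨((chartAt E c).symm.continuousAt hy).continuousWithinAt, ?_⟩
    simpa [DifferentiableWithinAtProp] using! hd.differentiableWithinAt
  refine Eq.trans (b := fderivWithin ℝ (coordChange c ((chartAt E c).symm y)) Set.univ y) ?_
    (by rw [fderivWithin_univ])
  refine Eq.trans hm.mfderiv ?_
  simp only [mfld_simps]
  rfl

/-- The value of a form, as an alternating form on the model space. -/
def val (η : ∀ x : M, Fibre E x) (r : ℕ) (x : M) : E [⋀^Fin r]→L[ℝ] ℂ := η x r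

theorem chartRep_eq [IsManifold 𝓘(ℂ, E) ω M] {c : M} {y : E} (hy : y ∈ (chartAt E c).target)
    (η : ∀ x : M, Fibre E x) (r : ℕ) :
    chartRep c η r y = (val η r ((chartAt E c).symm y)).compContinuousLinearMap
      (fderiv ℝ (coordChange c ((chartAt E c).symm y)) y) := by
  rw [← mfderiv_symm_eq hy]; rfl

theorem chartRep_center [IsManifold 𝓘(ℂ, E) ω M] (x : M)
    (η : ∀ x : M, Fibre E x) (r : ℕ) :
    chartRep x η r (chartAt E x x) = val η r x := by
  rw [chartRep_eq (mem_chart_target E x), (chartAt E x).left_inv (mem_chart_source E x)]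
  have : (coordChange x x : E → E) =ᶠ[𝓝 (chartAt E x x)] id := by
    filter_upwards [(chartAt E x).open_target.mem_nhds (mem_chart_target E x)] with z hz
    exact (chartAt E x).right_inv hz
  rw [this.fderiv_eq]
  ext v
  simp

theorem chartRep_change [IsManifold 𝓘(ℂ, E) ω M] {c c' : M} {y : E}
    (hy : y ∈ (chartAt E c).target) (hy' : (chartAt E c).symm y ∈ (chartAt E c').source)
    (η : ∀ x : M, Fibre E x) (r : ℕ) :
    chartRep c η r y = (chartRep c' η r (coordChange c c' y)).compContinuousLinearMap
      (fderiv ℝ (coordChange c c') y) := by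
  have e0 : (chartAt E c').symm (coordChange c c' y) = (chartAt E c).symm y :=
    (chartAt E c').left_inv hy'
  have h1 : coordChange c c' y ∈ (chartAt E c').target := (chartAt E c').map_source hy'
  rw [chartRep_eq hy, chartRep_eq h1, e0]
  set x := (chartAt E c).symm y with hx
  have hxs : x ∈ (chartAt E x).source := mem_chart_source E x
  have d1 : DifferentiableAt ℝ (coordChange c c' : E → E) y :=
    ((contDiffAt_coordChange hy hy').restrict_scalars ℝ).differentiableAt (by simp)
  have d2 : DifferentiableAt ℝ (coordChange c' x : E → E) (coordChange c c' y) :=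
    ((contDiffAt_coordChange h1 (by rw [e0]; exact hxs)).restrict_scalars ℝ).differentiableAt
      (by simp)
  have hc : (coordChange c x : E → E) =ᶠ[𝓝 y] coordChange c' x ∘ coordChange c c' := by
    filter_upwards [((chartAt E c).isOpen_inter_preimage_symm
      (chartAt E c').open_source).mem_nhds ⟨hy, hy'⟩] with z hz
    simp only [coordChange, Function.comp_apply]
    rw [(chartAt E c').left_inv hz.2]
  rw [hc.fderiv_eq, fderiv_comp y d2 d1]
  rfl

/-- The operator `∂` (`ε = -i`) or `∂̄` (`ε = i`) on forms on `M`. At `x` it is computed in the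
chart at `x`, through which the tangent space at `x` is identified with the model space. By
`chartRep_dForm` any other chart gives the same result. -/
def dForm (ε : ℂ) (η : ∀ x : M, Fibre E x) : ∀ x : M, Fibre E x
  | _, 0 => 0
  | x, r + 1 => dPart (E := E) ε (chartRep x η r) (chartAt E x x)

theorem chartRep_dForm [IsManifold 𝓘(ℂ, E) ω M] (ε : ℂ) {η : ∀ x : M, Fibre E x}
    {U : Opens M} {r : ℕ}
    (hη : ∀ c : M, ContDiffOn ℝ ∞ (chartRep c η r) (chartDom E c U)) {c : M} {y : E}
    (hy : y ∈ chartDom E c U) :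
    chartRep c (dForm ε η) (r + 1) y = dPart ε (chartRep c η r) y := by
  have hxs := mem_chart_source E ((chartAt E c).symm y)
  rw [chartRep_eq hy.1]
  set x := (chartAt E c).symm y with hx
  have hev : chartRep c η r =ᶠ[𝓝 y] fun z ↦
      (chartRep x η r (coordChange c x z)).compContinuousLinearMap
        (fderiv ℝ (coordChange c x) z) := by
    filter_upwards [((chartAt E c).isOpen_inter_preimage_symm
      (chartAt E x).open_source).mem_nhds ⟨hy.1, hxs⟩] with z hz
    exact chartRep_change hz.1 hz.2 η r
  have hcx : coordChange c x y = chartAt E x x := rfl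
  have hd : DifferentiableAt ℝ (chartRep x η r) (coordChange c x y) := by
    refine ((hη x).contDiffAt ((isOpen_chartDom x U).mem_nhds ⟨?_, ?_⟩)).differentiableAt (by simp)
    · rw [hcx]; exact mem_chart_target E x
    · rw [hcx, Set.mem_preimage, (chartAt E x).left_inv hxs]
      exact hy.2
  rw [dPart_congr ε hev, dPart_pullback ε hd
    ((contDiffAt_coordChange hy.1 hxs).of_le (by exact_mod_cast le_top)), hcx]
  rfl

theorem chartRep_congr {η θ : ∀ x : M, Fibre E x} {U : Opens M}
    (h : ∀ x ∈ U, η x = θ x) (c : M) (r : ℕ) :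
    Set.EqOn (chartRep c η r) (chartRep c θ r) (chartDom E c U) := by
  intro y hy
  rw [chartRep, chartRep, h _ hy.2]

theorem chartRep_add (η θ : ∀ x : M, Fibre E x) (c : M) (r : ℕ) (y : E) :
    chartRep c (fun x ↦ η x + θ x) r y = chartRep c η r y + chartRep c θ r y := rfl

theorem chartRep_smul (a : ℂ) (η : ∀ x : M, Fibre E x) (c : M) (r : ℕ) (y : E) :
    chartRep c (fun x ↦ a • η x) r y = a • chartRep c η r y := rfl

theorem homog_chartRep [IsManifold 𝓘(ℂ, E) ω M] {p q : ℤ} {η : ∀ x : M, Fibre E x} {r : ℕ}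
    {c : M} {y : E} (hy : y ∈ (chartAt E c).target)
    (h : Homog p q (val η r ((chartAt E c).symm y))) : Homog p q (chartRep c η r y) := by
  intro a ha v
  rw [chartRep_eq hy]
  have hd : DifferentiableAt ℂ (coordChange c ((chartAt E c).symm y) : E → E) y :=
    (contDiffAt_coordChange hy (mem_chart_source E _)).differentiableAt (by simp)
  rw [hd.fderiv_restrictScalars ℝ]
  have := h a ha (fun i ↦ fderiv ℂ (coordChange c ((chartAt E c).symm y)) y (v i))
  simpa [Function.comp_def] using this

end Manifold

section Forms

variable {E : Type} [NormedAddCommGroup E] [NormedSpace ℂ E]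
  {M : Type u} [TopologicalSpace M] [ChartedSpace E M]

theorem extendZero_apply {U : Opens M} (η : ∀ x : U, Fibre E (x : M)) (x : U) :
    extendZero η x = η x := by
  simp [extendZero]

theorem extendZero_add {U : Opens M} (η θ : ∀ x : U, Fibre E (x : M)) :
    extendZero (η + θ) = fun x ↦ extendZero η x + extendZero θ x := by
  funext x
  by_cases h : x ∈ U <;> simp [extendZero, h]

theorem extendZero_smul {U : Opens M} (a : ℂ) (η : ∀ x : U, Fibre E (x : M)) :
    extendZero (a • η) = fun x ↦ a • extendZero η x := by
  funext x
  by_cases h : x ∈ U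
  · simp [extendZero, h]
  · simp only [extendZero, h, dif_neg, not_false_eq_true]
    funext r
    exact ContinuousAlternatingMap.ext fun v ↦ (mul_zero a).symm

theorem extendZero_zero {U : Opens M} :
    extendZero (0 : ∀ x : U, Fibre E (x : M)) = 0 := by
  funext x
  by_cases h : x ∈ U <;> simp [extendZero, h]

/-- A form on `U` is `C^∞` if it is so in every chart. -/
def IsSmooth {U : Opens M} (η : ∀ x : U, Fibre E (x : M)) : Prop :=
  ∀ (c : M) (r : ℕ), ContDiffOn ℝ ∞ (chartRep c (extendZero η) r) (chartDom E c U)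

variable (E) in
/-- `𝓔^{p,q}(U)`, the space of `C^∞` complex valued differential forms of type `(p, q)` on `U`. -/
def forms (p q : ℤ) (U : Opens M) : Submodule ℂ (∀ x : U, Fibre E (x : M)) where
  carrier := {η | IsSmooth η ∧ ∀ x : U, IsType p q (x : M) (η x)}
  add_mem' := by
    rintro a b ⟨ha, ha'⟩ ⟨hb, hb'⟩
    refine ⟨fun c r ↦ ?_, fun x r ↦ ⟨fun hr ↦ ?_, fun z hz v ↦ ?_⟩⟩
    · rw [extendZero_add]
      exact (ha c r).add (hb c r)
    · rw [Pi.add_apply, Pi.add_apply, (ha' x r).1 hr, (hb' x r).1 hr, add_zero]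
    · have h1 := (ha' x r).2 z hz v
      have h2 := (hb' x r).2 z hz v
      exact (congrArg₂ (· + ·) h1 h2).trans (mul_add _ _ _).symm
  zero_mem' := by
    refine ⟨fun c r ↦ ?_, fun x r ↦ ⟨fun hr ↦ rfl, fun z hz v ↦ (mul_zero _).symm⟩⟩
    rw [extendZero_zero]
    exact contDiffOn_const (c := 0)
  smul_mem' := by
    rintro a b ⟨hb, hb'⟩
    refine ⟨fun c r ↦ ?_, fun x r ↦ ⟨fun hr ↦ ?_, fun z hz v ↦ ?_⟩⟩
    · rw [extendZero_smul]
      exact (hb c r).const_smul a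
    · rw [Pi.smul_apply, Pi.smul_apply, (hb' x r).1 hr]
      exact ContinuousAlternatingMap.ext fun v ↦ mul_zero a
    · have h2 := (hb' x r).2 z hz v
      exact (congrArg (a * ·) h2).trans (mul_left_comm _ _ _)

/-- `∂` (`ε = -i`) or `∂̄` (`ε = i`) of a form on the open set `U`. -/
def dOn (ε : ℂ) {U : Opens M} (η : ∀ x : U, Fibre E (x : M)) : ∀ x : U, Fibre E (x : M) :=
  fun x ↦ dForm ε (extendZero η) x

set_option linter.unusedSectionVars false in
theorem center_mem_chartDom {U : Opens M} {x : M} (hx : x ∈ U) :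
    chartAt E x x ∈ chartDom E x U :=
  ⟨mem_chart_target E x, by
    rw [Set.mem_preimage, (chartAt E x).left_inv (mem_chart_source E x)]; exact hx⟩

theorem isSmooth_dOn [IsManifold 𝓘(ℂ, E) ω M] (ε : ℂ) {U : Opens M}
    {η : ∀ x : U, Fibre E (x : M)} (h : IsSmooth η) : IsSmooth (dOn ε η) := by
  intro c r
  have hag : ∀ x ∈ U, extendZero (dOn ε η) x = dForm ε (extendZero η) x := fun x hx ↦ by
    simp [extendZero, hx, dOn]
  refine ContDiffOn.congr ?_ (chartRep_congr hag c r)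
  cases r with
  | zero => exact contDiffOn_const (c := 0)
  | succ r =>
    exact (contDiffOn_dPart ε (isOpen_chartDom c U) (h c r)).congr
      fun y hy ↦ chartRep_dForm ε (fun c ↦ h c r) hy

theorem differentiableAt_center {U : Opens M} {η : ∀ x : U, Fibre E (x : M)} (h : IsSmooth η)
    (x : U) (r : ℕ) :
    DifferentiableAt ℝ (chartRep (x : M) (extendZero η) r) (chartAt E (x : M) x) :=
  ((h x r).contDiffAt ((isOpen_chartDom _ U).mem_nhds
    (center_mem_chartDom x.2))).differentiableAt (by simp)

theorem eventually_homog [IsManifold 𝓘(ℂ, E) ω M] {p q : ℤ} {U : Opens M}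
    {η : ∀ x : U, Fibre E (x : M)} (h : ∀ x : U, IsType p q (x : M) (η x)) (x : U) (r : ℕ) :
    ∀ᶠ z in 𝓝 (chartAt E (x : M) x), Homog p q (chartRep (x : M) (extendZero η) r z) := by
  filter_upwards [(isOpen_chartDom _ U).mem_nhds (center_mem_chartDom x.2)] with z hz
  refine homog_chartRep hz.1 ?_
  have := (h ⟨_, hz.2⟩ r).2
  rwa [← extendZero_apply η ⟨_, hz.2⟩] at this

theorem eventually_zero {p q : ℤ} {U : Opens M}
    {η : ∀ x : U, Fibre E (x : M)} (h : ∀ x : U, IsType p q (x : M) (η x)) (x : U) (r : ℕ)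
    (hr : (r : ℤ) ≠ p + q) :
    chartRep (x : M) (extendZero η) r =ᶠ[𝓝 (chartAt E (x : M) x)] fun _ ↦ 0 := by
  filter_upwards [(isOpen_chartDom _ U).mem_nhds (center_mem_chartDom x.2)] with z hz
  have := (h ⟨_, hz.2⟩ r).1 hr
  rw [← extendZero_apply η ⟨_, hz.2⟩] at this
  rw [chartRep, this]
  rfl

theorem dPart_const_zero (ε : ℂ) (r : ℕ) (y : E) :
    dPart ε (fun _ ↦ (0 : E [⋀^Fin r]→L[ℝ] ℂ)) y = 0 := by
  rw [dPart_eq, fderiv_fun_const, Pi.zero_apply, map_zero]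

theorem del_mem [IsManifold 𝓘(ℂ, E) ω M] {p q p' : ℤ} (hp : p' = p + 1) {U : Opens M}
    {η : ∀ x : U, Fibre E (x : M)} (h : η ∈ forms E p q U) :
    dOn (-Complex.I) η ∈ forms E p' q U := by
  subst hp
  refine ⟨isSmooth_dOn _ h.1, fun x r ↦ ?_⟩
  cases r with
  | zero => exact ⟨fun _ ↦ rfl, fun z hz v ↦ (mul_zero _).symm⟩
  | succ r =>
    refine ⟨fun hr ↦ ?_, homog_del (differentiableAt_center h.1 x r) (eventually_homog h.2 x r)⟩
    exact (dPart_congr _ (eventually_zero h.2 x r (by push_cast at hr; omega))).trans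
      (dPart_const_zero _ _ _)

theorem delbar_mem [IsManifold 𝓘(ℂ, E) ω M] {p q q' : ℤ} (hq : q' = q + 1) {U : Opens M}
    {η : ∀ x : U, Fibre E (x : M)} (h : η ∈ forms E p q U) :
    dOn Complex.I η ∈ forms E p q' U := by
  subst hq
  refine ⟨isSmooth_dOn _ h.1, fun x r ↦ ?_⟩
  cases r with
  | zero => exact ⟨fun _ ↦ rfl, fun z hz v ↦ (mul_zero _).symm⟩
  | succ r =>
    refine ⟨fun hr ↦ ?_, homog_delbar (differentiableAt_center h.1 x r) (eventually_homog h.2 x r)⟩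
    exact (dPart_congr _ (eventually_zero h.2 x r (by push_cast at hr; omega))).trans
      (dPart_const_zero _ _ _)

theorem dOn_add (ε : ℂ) {U : Opens M} {η θ : ∀ x : U, Fibre E (x : M)}
    (hη : IsSmooth η) (hθ : IsSmooth θ) : dOn ε (η + θ) = dOn ε η + dOn ε θ := by
  funext x r
  cases r with
  | zero => exact (add_zero _).symm
  | succ r =>
    have := dPart_add ε (differentiableAt_center hη x r) (differentiableAt_center hθ x r)
    rw [dOn, extendZero_add]
    exact this

theorem dOn_smul (ε a : ℂ) {U : Opens M} {η : ∀ x : U, Fibre E (x : M)}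
    (hη : IsSmooth η) : dOn ε (a • η) = a • dOn ε η := by
  funext x r
  cases r with
  | zero => exact ContinuousAlternatingMap.ext fun v ↦ (mul_zero a).symm
  | succ r =>
    have := dPart_smul ε a (differentiableAt_center hη x r)
    rw [dOn, extendZero_smul]
    exact this

/-- Restriction of forms. -/
def restrictFun {U V : Opens M} (h : V ≤ U) (η : ∀ x : U, Fibre E (x : M)) :
    ∀ x : V, Fibre E (x : M) := fun x ↦ η ⟨x, h x.2⟩

theorem extendZero_restrictFun {U V : Opens M} (h : V ≤ U) (η : ∀ x : U, Fibre E (x : M)) :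
    ∀ x ∈ V, extendZero (restrictFun h η) x = extendZero η x := fun x hx ↦ by
  simp [extendZero, hx, h hx, restrictFun]

theorem restrictFun_mem {p q : ℤ} {U V : Opens M} (h : V ≤ U) {η : ∀ x : U, Fibre E (x : M)}
    (hη : η ∈ forms E p q U) : restrictFun h η ∈ forms E p q V :=
  ⟨fun c r ↦ ((hη.1 c r).mono fun _ hy ↦ ⟨hy.1, h hy.2⟩).congr
    (chartRep_congr (extendZero_restrictFun h η) c r), fun x ↦ hη.2 ⟨x, h x.2⟩⟩

theorem dOn_restrictFun (ε : ℂ) {U V : Opens M} (h : V ≤ U) (η : ∀ x : U, Fibre E (x : M)) :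
    dOn ε (restrictFun h η) = restrictFun h (dOn ε η) := by
  funext x r
  cases r with
  | zero => rfl
  | succ r =>
    refine dPart_congr (E := E) ε ?_
    filter_upwards [(isOpen_chartDom _ V).mem_nhds (center_mem_chartDom x.2)] with z hz
    exact chartRep_congr (extendZero_restrictFun h η) _ r hz

variable (E M) in
/-- The sheaf `𝓔^{p,q}` of `C^∞` forms of type `(p, q)` on `M`, as a presheaf. -/
def formPresheaf (p q : ℤ) : TopCat.Presheaf (ModuleCat.{u} ℂ) (TopCat.of M) where
  obj U := ModuleCat.of ℂ (forms (M := M) E p q U.unop)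
  map {U V} i := ModuleCat.ofHom
    { toFun := fun η ↦ ⟨restrictFun (leOfHom i.unop) η.1, restrictFun_mem _ η.2⟩
      map_add' := fun _ _ ↦ rfl
      map_smul' := fun _ _ ↦ rfl }

variable [IsManifold 𝓘(ℂ, E) ω M]

variable (E M) in
/-- `∂ : 𝓔^{p,q} ⟶ 𝓔^{p+1,q}`. -/
def del (p q p' : ℤ) (hp : p' = p + 1) : formPresheaf E M p q ⟶ formPresheaf E M p' q where
  app U := ModuleCat.ofHom
    { toFun := fun η ↦ ⟨dOn (-Complex.I) η.1, del_mem hp η.2⟩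
      map_add' := fun η θ ↦ Subtype.ext (dOn_add _ η.2.1 θ.2.1)
      map_smul' := fun a η ↦ Subtype.ext (dOn_smul _ a η.2.1) }
  naturality U V i := by
    ext η
    exact Subtype.ext (dOn_restrictFun _ (leOfHom i.unop) η.1)

variable (E M) in
/-- `∂̄ : 𝓔^{p,q} ⟶ 𝓔^{p,q+1}`. -/
def delbar (p q q' : ℤ) (hq : q' = q + 1) : formPresheaf E M p q ⟶ formPresheaf E M p q' where
  app U := ModuleCat.ofHom
    { toFun := fun η ↦ ⟨dOn Complex.I η.1, delbar_mem hq η.2⟩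
      map_add' := fun η θ ↦ Subtype.ext (dOn_add _ η.2.1 θ.2.1)
      map_smul' := fun a η ↦ Subtype.ext (dOn_smul _ a η.2.1) }
  naturality U V i := by
    ext η
    exact Subtype.ext (dOn_restrictFun _ (leOfHom i.unop) η.1)

end Forms

section Cech

variable {X : TopCat.{u}}

/-- The space of sections of `F` on the open set `U`. -/
abbrev Sec (F : TopCat.Presheaf (ModuleCat.{u} ℂ) X) (U : Opens X) : Type u := F.obj (op U)

/-- The restriction of sections. -/
def res (F : TopCat.Presheaf (ModuleCat.{u} ℂ) X) {U V : Opens X} (h : V ≤ U) :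
    Sec F U →ₗ[ℂ] Sec F V := (F.map (homOfLE h).op).hom

/-- The map on sections over `U` induced by a morphism of presheaves. -/
def onSec {F G : TopCat.Presheaf (ModuleCat.{u} ℂ) X} (f : F ⟶ G) (U : Opens X) :
    Sec F U →ₗ[ℂ] Sec G U := (f.app (op U)).hom

/-- The cochains `B(U₀) ⊕ B(U₁) ⊕ A(U₀ ∩ U₁)` of the two-set covering, where `A` and `B` are
consecutive terms `𝒦^{r-1}`, `𝒦^r` of a complex. -/
abbrev CechCochain (A B : TopCat.Presheaf (ModuleCat.{u} ℂ) X) (U₀ U₁ : Opens X) : Type u :=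
  Sec B U₀ × Sec B U₁ × Sec A (U₀ ⊓ U₁)

/-- The differential `D(σ₀, σ₁, σ₀₁) = (b σ₀, b σ₁, σ₁ - σ₀ - a σ₀₁)`, where `a : A ⟶ B` and
`b : B ⟶ C` are consecutive differentials of a complex. -/
def cechD {A B C : TopCat.Presheaf (ModuleCat.{u} ℂ) X} (a : A ⟶ B) (b : B ⟶ C)
    (U₀ U₁ : Opens X) : CechCochain A B U₀ U₁ →ₗ[ℂ] CechCochain B C U₀ U₁ where
  toFun σ := (onSec b U₀ σ.1, onSec b U₁ σ.2.1,
    res B inf_le_right σ.2.1 - res B inf_le_left σ.1 - onSec a (U₀ ⊓ U₁) σ.2.2)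
  map_add' σ τ := by
    simp only [Prod.fst_add, Prod.snd_add, map_add, Prod.mk_add_mk]
    congr 2
    abel
  map_smul' c σ := by
    simp only [Prod.smul_fst, Prod.smul_snd, map_smul, Prod.smul_mk, RingHom.id_apply, smul_sub]

/-- The map `w ↦ (w, w, 0)` from global sections to cochains. -/
def diag (A B : TopCat.Presheaf (ModuleCat.{u} ℂ) X) (U₀ U₁ : Opens X) :
    Sec B ⊤ →ₗ[ℂ] CechCochain A B U₀ U₁ where
  toFun w := (res B le_top w, res B le_top w, 0)
  map_add' _ _ := by simp
  map_smul' _ _ := by simp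

/-- The cohomology `ker g / im f` of `A ⟶ B ⟶ C` (for `g ∘ f = 0`, so that `im f` lies in
`ker g`). -/
abbrev Coh {A B C : Type u} [AddCommGroup A] [Module ℂ A] [AddCommGroup B] [Module ℂ B]
    [AddCommGroup C] [Module ℂ C] (f : A →ₗ[ℂ] B) (g : B →ₗ[ℂ] C) : Type u :=
  LinearMap.ker g ⧸ (LinearMap.range f).submoduleOf (LinearMap.ker g)

/-- The cohomology class of a cocycle. -/
def cls {A B C : Type u} [AddCommGroup A] [Module ℂ A] [AddCommGroup B] [Module ℂ B]
    [AddCommGroup C] [Module ℂ C] (f : A →ₗ[ℂ] B) (g : B →ₗ[ℂ] C) (w : LinearMap.ker g) :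
    Coh f g := Submodule.Quotient.mk w

variable {A B C D : TopCat.Presheaf (ModuleCat.{u} ℂ) X}

/-- The cohomology at `C` of the global sections of `B ⟶ C ⟶ D`. -/
abbrev GlobalCoh (b : B ⟶ C) (c : C ⟶ D) : Type u := Coh (onSec b ⊤) (onSec c ⊤)

/-- The Čech cohomology of the covering `U₀, U₁` at the term `C` of `A ⟶ B ⟶ C ⟶ D`. -/
abbrev CechCoh (a : A ⟶ B) (b : B ⟶ C) (c : C ⟶ D) (U₀ U₁ : Opens X) : Type u :=
  Coh (cechD a b U₀ U₁) (cechD b c U₀ U₁)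

/-- The map `w ↦ (w, w, 0)` is compatible with the differentials and maps cocycles to cocycles, and
`[w] ↦ [(w, w, 0)]` is a well-defined linear isomorphism from the cohomology of the global sections
of `B ⟶ C ⟶ D` onto the Čech cohomology of `A ⟶ B ⟶ C ⟶ D` at the term `C`. -/
def DiagInducesIso (a : A ⟶ B) (b : B ⟶ C) (c : C ⟶ D) (U₀ U₁ : Opens X) : Prop :=
  (∀ w : Sec C ⊤, cechD b c U₀ U₁ (diag B C U₀ U₁ w) = diag C D U₀ U₁ (onSec c ⊤ w)) ∧
  ∃ α : GlobalCoh b c ≃ₗ[ℂ] CechCoh a b c U₀ U₁,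
    ∀ w : LinearMap.ker (onSec c ⊤),
      ∃ h : diag B C U₀ U₁ w ∈ LinearMap.ker (cechD b c U₀ U₁),
        α (cls _ _ w) = cls _ _ ⟨diag B C U₀ U₁ w, h⟩

/-- The direct sum of two presheaves. -/
def prodPresheaf (F G : TopCat.Presheaf (ModuleCat.{u} ℂ) X) :
    TopCat.Presheaf (ModuleCat.{u} ℂ) X where
  obj U := ModuleCat.of ℂ (F.obj U × G.obj U)
  map i := ModuleCat.ofHom ((F.map i).hom.prodMap (G.map i).hom)

end Cech

section Smooth
variable {E : Type} [NormedAddCommGroup E] [NormedSpace ℂ E]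
  {M : Type u} [TopologicalSpace M] [ChartedSpace E M]

variable (E) in
/-- The structure of a sheaf of modules over the sheaf of real valued `C^∞` functions on `M`, acting
by complex-linear maps, as sheaves of `C^∞` differential forms have it. -/
structure SmoothModule (F : TopCat.Presheaf (ModuleCat.{u} ℂ) (TopCat.of M)) where
  /-- The action of `C^∞(U)` on `F(U)`. -/
  act (U : Opens M) : C^∞⟮𝓘(ℝ, E), U; 𝓘(ℝ, ℝ), ℝ⟯ →+* Module.End ℂ (Sec F U)
  /-- The actions are compatible with restriction. -/
  act_res {U V : Opens M} (h : V ≤ U) (f : C^∞⟮𝓘(ℝ, E), U; 𝓘(ℝ, ℝ), ℝ⟯) (s : Sec F U) :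
    res F h (act U f s) = act V (ContMDiffMap.restrictRingHom 𝓘(ℝ, E) 𝓘(ℝ, ℝ) ℝ h f) (res F h s)

end Smooth

section Mixed
variable (E : Type) [NormedAddCommGroup E] [NormedSpace ℂ E]
  (M : Type u) [TopologicalSpace M] [ChartedSpace E M]

/-- `𝓔^{(p,q)+1} = 𝓔^{p+1,q} ⊕ 𝓔^{p,q+1}`. -/
def formPresheafSucc (p q : ℤ) : TopCat.Presheaf (ModuleCat.{u} ℂ) (TopCat.of M) :=
  prodPresheaf (formPresheaf E M (p + 1) q) (formPresheaf E M p (q + 1))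

variable [IsManifold 𝓘(ℂ, E) ω M]

/-- `d : 𝓔^{p,q} ⟶ 𝓔^{(p,q)+1}`, that is, `η ↦ (∂ η, ∂̄ η)`. -/
def dSplit (p q : ℤ) : formPresheaf E M p q ⟶ formPresheafSucc E M p q where
  app U := ModuleCat.ofHom (((del E M p q (p + 1) rfl).app U).hom.prod
    ((delbar E M p q (q + 1) rfl).app U).hom)
  naturality U V i := by
    ext η
    exact Prod.ext (ConcreteCategory.congr_hom ((del E M p q (p + 1) rfl).naturality i) η)
      (ConcreteCategory.congr_hom ((delbar E M p q (q + 1) rfl).naturality i) η)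

/-- `∂̄ + ∂ : 𝓔^{(p,q)+1} ⟶ 𝓔^{p+1,q+1}`, that is, `(η₁, η₂) ↦ ∂̄ η₁ + ∂ η₂`. -/
def delbarAddDel (p q p' q' : ℤ) (hp : p' = p + 1 := by omega) (hq : q' = q + 1 := by omega) :
    formPresheafSucc E M p q ⟶ formPresheaf E M p' q' :=
  { app := fun U ↦ ModuleCat.ofHom
      { toFun := fun η ↦ (⟨dOn Complex.I η.1.1 + dOn (-Complex.I) η.2.1, by
            subst hp
            subst hq
            exact add_mem (delbar_mem rfl η.1.2) (del_mem rfl η.2.2)⟩ :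
            forms (M := M) E p' q' U.unop)
        map_add' := fun η θ ↦ by
          refine Subtype.ext ?_
          have h1 := dOn_add Complex.I η.1.2.1 θ.1.2.1
          have h2 := dOn_add (-Complex.I) η.2.2.1 θ.2.2.1
          exact (congrArg₂ (· + ·) h1 h2).trans (add_add_add_comm _ _ _ _)
        map_smul' := fun a η ↦ by
          refine Subtype.ext ?_
          have h1 := dOn_smul Complex.I a η.1.2.1
          have h2 := dOn_smul (-Complex.I) a η.2.2.1
          exact (congrArg₂ (· + ·) h1 h2).trans (smul_add a _ _).symm }
    naturality := fun U V i ↦ by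
      ext η
      refine Subtype.ext ?_
      exact congrArg₂ (· + ·) (dOn_restrictFun _ (leOfHom i.unop) η.1.1)
        (dOn_restrictFun _ (leOfHom i.unop) η.2.1) }

/-- `∂̄∂ : 𝓔^{p,q} ⟶ 𝓔^{p+1,q+1}`. -/
def delbarDel (p q p' q' : ℤ) (hp : p' = p + 1 := by omega) (hq : q' = q + 1 := by omega) :
    formPresheaf E M p q ⟶ formPresheaf E M p' q' :=
  del E M p q p' hp ≫ delbar E M p' q q' hq
end Mixed

end CechForms

end

open CechForms

namespace CechForms

/-! ### Two-set coverings: gluing, splitting over the intersection, and the diagram chase. -/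

section TwoSets

variable {X : TopCat.{u}}

/-! For each sheaf `F` in question the Mayer–Vietoris sequence `0 → F(M) → F(U₀) ⊕ F(U₁) → F(U₀ ∩
U₁) → 0` is exact. Exactness on the left and in the middle is the sheaf condition for two sets
(`GluesPairs`). Surjectivity on the right (`DifferenceOnto`) comes from a partition of unity: if the
smooth function `f` vanishes near the complement of `U₀` and is `1` near that of `U₁`, then for a
section `s` over the intersection `f s` extends by zero to `U₁`, `(1 - f) s` extends by zero to
`U₀`, and their sum is `s`.

Given this, a Čech cochain can be corrected by a coboundary so that its component on the
intersection vanishes, and the two remaining components then glue to a global section. This chase,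
`diagInducesIso_of_gluesPairs`, concerns only four consecutive terms `A ⟶ B ⟶ C ⟶ D` with vanishing
composites. It asks for gluing in `B`, `C`, `D` and for splitting in `A`, `B`, so it covers the
ordinary, the Bott–Chern and the Aeppli case at once.

What remains is to check these hypotheses. The composites in the Bott–Chern and Aeppli complexes
vanish because `∂² = ∂̄² = 0` and `∂∂̄ = -∂̄∂`, which all come from the symmetry of second
derivatives (`dPart_dPart_add_dPart_dPart`). Forms glue because smoothness is local and type is
pointwise (`gluesPairs_formPresheaf`). The splitting is `SmoothModule.differenceOnto` for abstract
modules and `differenceOnto_formPresheaf` for forms; direct sums are treated componentwise. -/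

theorem res_res (F : TopCat.Presheaf (ModuleCat.{u} ℂ) X) {U V W : Opens X} (h : V ≤ U)
    (h' : W ≤ V) (s : Sec F U) : res F h' (res F h s) = res F (h'.trans h) s := by
  simp only [res, ← LinearMap.comp_apply, ← ModuleCat.hom_comp, ← F.map_comp]
  rfl

theorem onSec_res {F G : TopCat.Presheaf (ModuleCat.{u} ℂ) X} (f : F ⟶ G) {U V : Opens X}
    (h : V ≤ U) (s : Sec F U) : onSec f V (res F h s) = res G h (onSec f U s) :=
  ConcreteCategory.congr_hom (f.naturality (homOfLE h).op) s

/-- The sheaf condition for coverings by two open sets. -/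
structure GluesPairs (F : TopCat.Presheaf (ModuleCat.{u} ℂ) X) : Prop where
  eq_of_res {U V W : Opens X} (hU : U ≤ W) (hV : V ≤ W) (hW : W ≤ U ⊔ V) {s t : Sec F W} :
    res F hU s = res F hU t → res F hV s = res F hV t → s = t
  exists_glue {U V W : Opens X} (hU : U ≤ W) (hV : V ≤ W) (hW : W ≤ U ⊔ V)
    (s : Sec F U) (t : Sec F V) :
    res F (inf_le_left : U ⊓ V ≤ U) s = res F (inf_le_right : U ⊓ V ≤ V) t →
      ∃ w : Sec F W, res F hU w = s ∧ res F hV w = t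

theorem gluesPairs_of_isSheaf (F : TopCat.Sheaf (ModuleCat.{u} ℂ) X) : GluesPairs F.1 where
  eq_of_res hU hV hW s t h₁ h₂ :=
    F.eq_of_locally_eq₂ (homOfLE hU) (homOfLE hV) hW s t h₁ h₂
  exists_glue {U V W} hU hV hW s t h := by
    -- `true` indexes `U` and `false` indexes `V`; the overlap of the pair `(false, true)` is `V ⊓
    -- U`, so compatibility there has to be carried across `inf_comm`.
    let P : Bool → Opens X := fun i ↦ Bool.rec V U i
    let sf : ∀ i : Bool, Sec F.1 (P i) := fun i ↦ Bool.rec t s i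
    have hP : ∀ i, P i ≤ W := by rintro (_ | _) <;> assumption
    have hsf : TopCat.Presheaf.IsCompatible F.1 P sf := by
      rintro (_ | _) (_ | _)
      · rfl
      · have := congrArg (res F.1 (inf_comm V U).le) h
        rw [res_res, res_res] at this
        exact this.symm
      · exact h
      · rfl
    obtain ⟨w, hw, -⟩ := F.existsUnique_gluing' P W (fun i ↦ homOfLE (hP i))
      (hW.trans (sup_le (le_iSup P true) (le_iSup P false))) sf hsf
    exact ⟨w, hw true, hw false⟩

/-- Both components can be glued separately. This handles `𝓔^{(p,q)+1}` without showing that the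
direct sum is a sheaf. -/
theorem GluesPairs.prod {F G : TopCat.Presheaf (ModuleCat.{u} ℂ) X} (hF : GluesPairs F)
    (hG : GluesPairs G) : GluesPairs (prodPresheaf F G) where
  eq_of_res hU hV hW s t h₁ h₂ :=
    Prod.ext (hF.eq_of_res hU hV hW (congrArg Prod.fst h₁) (congrArg Prod.fst h₂))
      (hG.eq_of_res hU hV hW (congrArg Prod.snd h₁) (congrArg Prod.snd h₂))
  exists_glue hU hV hW s t h := by
    obtain ⟨w₁, h₁, h₁'⟩ := hF.exists_glue hU hV hW s.1 t.1 (congrArg Prod.fst h)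
    obtain ⟨w₂, h₂, h₂'⟩ := hG.exists_glue hU hV hW s.2 t.2 (congrArg Prod.snd h)
    exact ⟨(w₁, w₂), Prod.ext h₁ h₂, Prod.ext h₁' h₂'⟩

/-- Every section over `U ⊓ V` is the difference of a section over `V` and one over `U`. -/
def DifferenceOnto (F : TopCat.Presheaf (ModuleCat.{u} ℂ) X) (U V : Opens X) : Prop :=
  ∀ s : Sec F (U ⊓ V), ∃ (x : Sec F U) (y : Sec F V),
    res F inf_le_right y - res F inf_le_left x = s

theorem DifferenceOnto.prod {F G : TopCat.Presheaf (ModuleCat.{u} ℂ) X} {U V : Opens X}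
    (hF : DifferenceOnto F U V) (hG : DifferenceOnto G U V) :
    DifferenceOnto (prodPresheaf F G) U V := by
  intro s
  obtain ⟨x₁, y₁, h₁⟩ := hF s.1
  obtain ⟨x₂, y₂, h₂⟩ := hG s.2
  exact ⟨(x₁, x₂), (y₁, y₂), Prod.ext h₁ h₂⟩

/-- A natural endomorphism that vanishes over the subsets of `W` turns sections over `U ⊓ V` into
restrictions of sections over `U` if `U ≤ V ⊔ W`. -/
theorem GluesPairs.exists_extend {F : TopCat.Presheaf (ModuleCat.{u} ℂ) X} (hF : GluesPairs F)
    {U V W : Opens X} (hW : U ≤ V ⊔ W) (m : ∀ O : Opens X, Sec F O →ₗ[ℂ] Sec F O)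
    (m_res : ∀ {O O' : Opens X} (h : O' ≤ O) (s : Sec F O), m O' (res F h s) = res F h (m O s))
    (m_zero : ∀ O ≤ W, m O = 0) {Y : Opens X} (hY : Y ≤ U) (hY' : U ⊓ V ≤ Y) (s : Sec F Y) :
    ∃ x : Sec F U, res F hY x = m Y s := by
  -- Extension by zero: `m Y s` on `Y` is glued with `0` on `U ⊓ W`. The two agree on the overlap,
  -- which lies in `W`, where `m` vanishes. Keeping `Y` general lets the lemma be used with `U` and
  -- `V` exchanged while `s` stays over `U ⊓ V`.
  have hcov : U ≤ Y ⊔ (U ⊓ W) := fun x hx ↦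
    (hW hx).imp (fun h ↦ hY' ⟨hx, h⟩) (fun h ↦ ⟨hx, h⟩)
  obtain ⟨x, hx, -⟩ := hF.exists_glue hY inf_le_left hcov (m Y s) 0 (by
    rw [← m_res, m_zero _ (inf_le_right.trans inf_le_right), map_zero]; rfl)
  exact ⟨x, hx⟩

theorem GluesPairs.differenceOnto {F : TopCat.Presheaf (ModuleCat.{u} ℂ) X} (hF : GluesPairs F)
    {U V W W' : Opens X} (hW : U ⊔ W = ⊤) (hW' : V ⊔ W' = ⊤)
    (m m' : ∀ O : Opens X, Sec F O →ₗ[ℂ] Sec F O)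
    (m_res : ∀ {O O' : Opens X} (h : O' ≤ O) (s : Sec F O), m O' (res F h s) = res F h (m O s))
    (m'_res : ∀ {O O' : Opens X} (h : O' ≤ O) (s : Sec F O), m' O' (res F h s) = res F h (m' O s))
    (m_zero : ∀ O ≤ W, m O = 0) (m'_zero : ∀ O ≤ W', m' O = 0)
    (m_add : ∀ O s, m O s + m' O s = s) : DifferenceOnto F U V := by
  intro s
  -- `m' s` extends to `U` because `m'` dies on `W'`, which covers the complement of `V`;
  -- symmetrically `m s` extends to `V`. The sign in the witness `-x` turns the difference into `m s
  -- + m' s = s`.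
  obtain ⟨x, hx⟩ := hF.exists_extend (U := U) (V := V) (W := W') (by rw [hW']; exact le_top)
    m' m'_res m'_zero inf_le_left le_rfl s
  obtain ⟨y, hy⟩ := hF.exists_extend (U := V) (V := U) (W := W) (by rw [hW]; exact le_top)
    m m_res m_zero inf_le_right (inf_comm V U).le s
  refine ⟨-x, y, ?_⟩
  rw [map_neg, hx, hy, sub_neg_eq_add, m_add]

section DiagIso

variable {A B C D : TopCat.Presheaf (ModuleCat.{u} ℂ) X} {a : A ⟶ B} {b : B ⟶ C} {c : C ⟶ D}
  {U₀ U₁ : Opens X}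

theorem cechD_diag (w : Sec C ⊤) :
    cechD b c U₀ U₁ (diag B C U₀ U₁ w) = diag C D U₀ U₁ (onSec c ⊤ w) := by
  simp only [cechD, diag, LinearMap.coe_mk, AddHom.coe_mk, onSec_res, res_res, sub_self, map_zero]

/-- The map `w ↦ (w, w, 0)` on cocycles. -/
noncomputable def diagKer (b : B ⟶ C) (c : C ⟶ D) (U₀ U₁ : Opens X) :
    LinearMap.ker (onSec c ⊤) →ₗ[ℂ] LinearMap.ker (cechD b c U₀ U₁) :=
  (diag B C U₀ U₁).restrict fun w hw ↦ by
    rw [LinearMap.mem_ker] at hw ⊢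
    rw [cechD_diag, hw, map_zero]

/-- The image of `b η` is `D (η, η, 0)`, so the map on cocycles descends to cohomology. -/
theorem range_le_comap_diagKer (a : A ⟶ B) (b : B ⟶ C) (c : C ⟶ D) (U₀ U₁ : Opens X) :
    (LinearMap.range (onSec b ⊤)).submoduleOf (LinearMap.ker (onSec c ⊤)) ≤
      ((LinearMap.range (cechD a b U₀ U₁)).submoduleOf
        (LinearMap.ker (cechD b c U₀ U₁))).comap (diagKer b c U₀ U₁) := by
  rintro w ⟨η, hη⟩
  exact ⟨diag A B U₀ U₁ η, by rw [cechD_diag, hη]; rfl⟩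

theorem diagInducesIso_of_gluesPairs (hab : ∀ (U : Opens X) s, onSec b U (onSec a U s) = 0)
    (hbc : ∀ (U : Opens X) s, onSec c U (onSec b U s) = 0) (hB : GluesPairs B) (hC : GluesPairs C)
    (hD : GluesPairs D) (dA : DifferenceOnto A U₀ U₁) (dB : DifferenceOnto B U₀ U₁)
    (hU : U₀ ⊔ U₁ = ⊤) : DiagInducesIso a b c U₀ U₁ := by
  refine ⟨cechD_diag, ?_⟩
  let f : GlobalCoh b c →ₗ[ℂ] CechCoh a b c U₀ U₁ :=
    Submodule.mapQ _ _ (diagKer b c U₀ U₁) (range_le_comap_diagKer a b c U₀ U₁)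
  have hf : Function.Bijective f := by
    constructor
    · rw [← LinearMap.ker_eq_bot, LinearMap.ker_eq_bot']
      intro x hx
      obtain ⟨w, rfl⟩ := Submodule.Quotient.mk_surjective _ x
      obtain ⟨⟨τ₀, τ₁, τ₀₁⟩, hτ⟩ := (Submodule.Quotient.mk_eq_zero _).1 hx
      have h₀ : onSec b U₀ τ₀ = res C le_top w.1 := congrArg Prod.fst hτ
      have h₁ : onSec b U₁ τ₁ = res C le_top w.1 := congrArg (fun z ↦ z.2.1) hτ
      have h₀₁ : res B inf_le_right τ₁ - res B inf_le_left τ₀ - onSec a (U₀ ⊓ U₁) τ₀₁ = 0 :=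
        congrArg (fun z ↦ z.2.2) hτ
      -- Injectivity: with `τ₀₁ = ρ₁ - ρ₀`, the relation `τ₁ - τ₀ = a τ₀₁` says that the `τᵢ - a ρᵢ`
      -- agree on the overlap. They glue to a global primitive of `w`, since `b ∘ a = 0`.
      obtain ⟨ρ₀, ρ₁, rfl⟩ := dA τ₀₁
      obtain ⟨τ, e₀, e₁⟩ := hB.exists_glue (W := ⊤) le_top le_top hU.ge
        (τ₀ - onSec a U₀ ρ₀) (τ₁ - onSec a U₁ ρ₁) (by
          rw [map_sub, onSec_res, onSec_res] at h₀₁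
          rw [map_sub, map_sub, ← sub_eq_zero, ← neg_eq_zero, ← h₀₁]
          abel)
      refine (Submodule.Quotient.mk_eq_zero _).2 ⟨τ, hC.eq_of_res le_top le_top hU.ge ?_ ?_⟩
      · rw [← onSec_res, e₀, map_sub, hab, sub_zero]
        exact h₀
      · rw [← onSec_res, e₁, map_sub, hab, sub_zero]
        exact h₁
    · intro x
      obtain ⟨⟨⟨σ₀, σ₁, σ₀₁⟩, hσ⟩, rfl⟩ := Submodule.Quotient.mk_surjective _ x
      have h₀ : onSec c U₀ σ₀ = 0 := congrArg Prod.fst hσ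
      have h₁ : onSec c U₁ σ₁ = 0 := congrArg (fun z ↦ z.2.1) hσ
      have h₀₁ : res C inf_le_right σ₁ - res C inf_le_left σ₀ - onSec b (U₀ ⊓ U₁) σ₀₁ = 0 :=
        congrArg (fun z ↦ z.2.2) hσ
      -- Surjectivity: the same correction one degree higher makes the `σᵢ - b ρᵢ` glue to a global
      -- cocycle `w`.
      obtain ⟨ρ₀, ρ₁, rfl⟩ := dB σ₀₁
      obtain ⟨w, e₀, e₁⟩ := hC.exists_glue (W := ⊤) le_top le_top hU.ge
        (σ₀ - onSec b U₀ ρ₀) (σ₁ - onSec b U₁ ρ₁) (by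
          rw [map_sub, onSec_res, onSec_res] at h₀₁
          rw [map_sub, map_sub, ← sub_eq_zero, ← neg_eq_zero, ← h₀₁]
          abel)
      have hw : onSec c ⊤ w = 0 := by
        refine hD.eq_of_res le_top le_top hU.ge ?_ ?_
        · rw [← onSec_res, e₀, map_sub, hbc, h₀, sub_zero, map_zero]
        · rw [← onSec_res, e₁, map_sub, hbc, h₁, sub_zero, map_zero]
      -- Since `w = σᵢ - b ρᵢ` on `Uᵢ` and `σ₀₁ = ρ₁ - ρ₀`, the cochain `(w, w, 0) - σ` is `D (-ρ₀,
      -- -ρ₁, 0)`.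
      refine ⟨Submodule.Quotient.mk ⟨w, hw⟩, (Submodule.Quotient.eq _).2 ⟨(-ρ₀, -ρ₁, 0), ?_⟩⟩
      change ((onSec b U₀ (-ρ₀), onSec b U₁ (-ρ₁),
          res B inf_le_right (-ρ₁) - res B inf_le_left (-ρ₀) - onSec a (U₀ ⊓ U₁) 0) :
            CechCochain B C U₀ U₁) =
        (res C le_top w - σ₀, res C le_top w - σ₁,
          0 - (res B inf_le_right ρ₁ - res B inf_le_left ρ₀))
      rw [e₀, e₁]
      simp only [map_neg, map_zero]
      refine Prod.ext ?_ (Prod.ext ?_ ?_) <;> simp only <;> abel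
  exact ⟨LinearEquiv.ofBijective f hf, fun w ↦ ⟨(diagKer b c U₀ U₁ w).2, rfl⟩⟩

end DiagIso

end TwoSets

end CechForms

namespace CechForms

/-! ### Anticommutation of `∂` and `∂̄` on the model space. -/

section Squares

theorem fderiv_clm_comp_fderiv {V A B : Type*} [NormedAddCommGroup V] [NormedSpace ℝ V]
    [NormedAddCommGroup A] [NormedSpace ℝ A] [NormedAddCommGroup B] [NormedSpace ℝ B]
    (T : (V →L[ℝ] A) →L[ℝ] B) {f : V → A} {y : V} (hf : ContDiffAt ℝ 2 f y) :
    fderiv ℝ (fun z ↦ T (fderiv ℝ f z)) y = T ∘L fderiv ℝ (fderiv ℝ f) y :=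
  (T.hasFDerivAt.comp y ((hf.fderiv_right (m := 1) (by norm_num)).differentiableAt
    (by simp)).hasFDerivAt).fderiv

variable {E : Type} [NormedAddCommGroup E] [NormedSpace ℂ E]

/-- `dPart ε' F` is a fixed continuous linear map applied to `fderiv ℝ F`, so its derivative
involves only the second derivative of `F`. The outer `partOf` is expanded and produces the term
with `mulI E`. -/
theorem dPart_dPart_eq (ε ε' : ℂ) {r : ℕ} {F : E → E [⋀^Fin r]→L[ℝ] ℂ} {y : E}
    (hF : ContDiffAt ℝ 2 F y) :
    dPart ε (dPart ε' F) y = (1 / 2 : ℂ) •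
      (ContinuousAlternatingMap.alternatizeUncurryFin
        (ContinuousAlternatingMap.alternatizeUncurryFinCLM ℝ E ℂ ∘L
          (partCLM ε' r ∘L fderiv ℝ (fderiv ℝ F) y)) +
      ε • ContinuousAlternatingMap.alternatizeUncurryFin
        (ContinuousAlternatingMap.alternatizeUncurryFinCLM ℝ E ℂ ∘L
          (partCLM ε' r ∘L (fderiv ℝ (fderiv ℝ F) y ∘L mulI E)))) := by
  have h : fderiv ℝ (dPart ε' F) y = (ContinuousAlternatingMap.alternatizeUncurryFinCLM ℝ E ℂ ∘L
      partCLM ε' r) ∘L fderiv ℝ (fderiv ℝ F) y :=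
    fderiv_clm_comp_fderiv (A := E [⋀^Fin r]→L[ℝ] ℂ) (B := E [⋀^Fin (r + 1)]→L[ℝ] ℂ)
      (ContinuousAlternatingMap.alternatizeUncurryFinCLM ℝ E ℂ ∘L partCLM ε' r) hF
  rw [dPart, h, partOf, ContinuousAlternatingMap.alternatizeUncurryFin_smul,
    ContinuousAlternatingMap.alternatizeUncurryFin_add,
    ContinuousAlternatingMap.alternatizeUncurryFin_smul]
  rfl

/-- With `H` the second derivative and `J` multiplication by `i`, the expression being alternated
is, up to a factor, `H(v + εJv, w + ε'Jw) + H(v + ε'Jv, w + εJw)`. It is symmetric in `v` and `w`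
because `H` is, so alternation kills it. This holds for arbitrary `ε`, `ε'`: equal values give the
squares, `∓i` the mixed relation. -/
theorem dPart_dPart_add_dPart_dPart (ε ε' : ℂ) {r : ℕ} {F : E → E [⋀^Fin r]→L[ℝ] ℂ} {y : E}
    (hF : ContDiffAt ℝ 2 F y) :
    dPart ε (dPart ε' F) y + dPart ε' (dPart ε F) y = 0 := by
  have hsymm : ∀ v w, fderiv ℝ (fderiv ℝ F) y v w = fderiv ℝ (fderiv ℝ F) y w v :=
    hF.isSymmSndFDerivAt (by simp)
  rw [dPart_dPart_eq ε ε' hF, dPart_dPart_eq ε' ε hF]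
  ext v
  simp only [ContinuousAlternatingMap.add_apply, ContinuousAlternatingMap.smul_apply,
    ContinuousAlternatingMap.alternatizeUncurryFin_alternatizeUncurryFinCLM_comp_apply,
    ContinuousAlternatingMap.coe_zero, Pi.zero_apply, smul_eq_mul, Finset.mul_sum, ← Finset.sum_add_distrib]
  -- The double alternation is a sum over pairs of slots of differences with the two arguments
  -- swapped, and each summand already vanishes.
  refine Finset.sum_eq_zero fun i _ ↦ Finset.sum_eq_zero fun j _ ↦ ?_
  simp only [ContinuousLinearMap.comp_apply, partCLM_apply, partOf_apply, zsmul_eq_mul]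
  -- The factor `Complex.I • v` coming from `partOf_apply` is rewritten as `mulI E v`, the form in
  -- which the symmetry rewrites below are stated.
  change _ * (_ * (1 / 2 * (_ + ε' * fderiv ℝ (fderiv ℝ F) y _ (mulI E _) _) -
    1 / 2 * (_ + ε' * fderiv ℝ (fderiv ℝ F) y _ (mulI E _) _)) + ε * (_ * (1 / 2 *
      (_ + ε' * fderiv ℝ (fderiv ℝ F) y _ (mulI E _) _) -
    1 / 2 * (_ + ε' * fderiv ℝ (fderiv ℝ F) y _ (mulI E _) _)))) + _ * (_ * (1 / 2 *
      (_ + ε * fderiv ℝ (fderiv ℝ F) y _ (mulI E _) _) -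
    1 / 2 * (_ + ε * fderiv ℝ (fderiv ℝ F) y _ (mulI E _) _)) + ε' * (_ * (1 / 2 *
      (_ + ε * fderiv ℝ (fderiv ℝ F) y _ (mulI E _) _) -
    1 / 2 * (_ + ε * fderiv ℝ (fderiv ℝ F) y _ (mulI E _) _)))) = 0
  rw [hsymm (v j.succ) (v i.castSucc), hsymm (mulI E (v i.castSucc)) (mulI E (v j.succ)),
    hsymm (mulI E (v i.castSucc)) (v j.succ), hsymm (mulI E (v j.succ)) (v i.castSucc)]
  ring

end Squares

/-! ### Relations between `∂` and `∂̄` on the manifold. -/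

section FormOperators

variable {E : Type} [NormedAddCommGroup E] [NormedSpace ℂ E]
  {M : Type u} [TopologicalSpace M] [ChartedSpace E M] [IsManifold 𝓘(ℂ, E) ω M]

theorem dOn_dOn_add_dOn_dOn (ε ε' : ℂ) {U : Opens M} {η : ∀ x : U, Fibre E (x : M)}
    (hη : IsSmooth η) : dOn ε (dOn ε' η) + dOn ε' (dOn ε η) = 0 := by
  have key (ε : ℂ) (x : U) (r : ℕ) :
      chartRep (x : M) (extendZero (dOn ε η)) (r + 1) =ᶠ[𝓝 (chartAt E (x : M) x)]
        dPart ε (chartRep (x : M) (extendZero η) r) := by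
    filter_upwards [(isOpen_chartDom _ U).mem_nhds (center_mem_chartDom x.2)] with z hz
    rw [← chartRep_dForm ε (fun c ↦ hη c r) hz]
    exact chartRep_congr (U := U) (fun y hy ↦ extendZero_apply (dOn ε η) ⟨y, hy⟩) _ _ hz
  -- Degree one is separate: the degree-zero component of `dOn ε' η` is zero by definition, not a
  -- `dPart`, so `key` does not apply to it.
  have low (ε ε' : ℂ) (x : U) : dOn ε (dOn ε' η) x 1 = 0 := by
    have h : chartRep (x : M) (extendZero (dOn ε' η)) 0 = fun _ ↦ 0 := by
      funext z
      by_cases hz : (chartAt E (x : M)).symm z ∈ U <;> simp only [chartRep, extendZero, hz] <;> rfl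
    exact (congrArg (fun G ↦ dPart ε G (chartAt E (x : M) x)) h).trans (dPart_const_zero _ _ _)
  funext x r
  match r with
  | 0 => exact add_zero _
  | 1 =>
    change dOn ε (dOn ε' η) x 1 + dOn ε' (dOn ε η) x 1 = 0
    rw [low, low, add_zero]
  | r + 2 =>
    refine Eq.trans (congrArg₂ (· + ·) (dPart_congr (E := E) ε (key ε' x r))
      (dPart_congr (E := E) ε' (key ε x r))) (dPart_dPart_add_dPart_dPart ε ε' ?_)
    exact (((hη x r).contDiffAt ((isOpen_chartDom _ U).mem_nhds
      (center_mem_chartDom x.2)))).of_le (by norm_cast)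

theorem dOn_dOn_comm (ε ε' : ℂ) {U : Opens M} {η : ∀ x : U, Fibre E (x : M)}
    (hη : IsSmooth η) : dOn ε (dOn ε' η) = -dOn ε' (dOn ε η) :=
  eq_neg_of_add_eq_zero_left (dOn_dOn_add_dOn_dOn ε ε' hη)

/-- The case `ε' = ε` of anticommutation reads `2 x = 0`. -/
theorem dOn_dOn_self (ε : ℂ) {U : Opens M} {η : ∀ x : U, Fibre E (x : M)}
    (hη : IsSmooth η) : dOn ε (dOn ε η) = 0 := by
  funext x r
  exact ContinuousAlternatingMap.ext fun v ↦ add_self_eq_zero.1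
    (congrArg (fun θ : ∀ x : U, Fibre E (x : M) ↦ θ x r v) (dOn_dOn_add_dOn_dOn ε ε hη))

omit [IsManifold 𝓘(ℂ, E) ω M] in
theorem dOn_zero (ε : ℂ) {U : Opens M} : dOn ε (0 : ∀ x : U, Fibre E (x : M)) = 0 := by
  funext x r
  cases r with
  | zero => rfl
  | succ r =>
    change dPart ε (chartRep (x : M) (extendZero 0) r) _ = 0
    rw [extendZero_zero]
    exact dPart_const_zero _ _ _

omit [IsManifold 𝓘(ℂ, E) ω M] in
theorem dOn_neg (ε : ℂ) {U : Opens M} {η : ∀ x : U, Fibre E (x : M)} (hη : IsSmooth η) :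
    dOn ε (-η) = -dOn ε η := by
  have h (θ : ∀ x : U, Fibre E (x : M)) : -θ = (-1 : ℂ) • θ := by
    funext x r
    exact ContinuousAlternatingMap.ext fun v ↦ (neg_one_mul _).symm
  rw [h, dOn_smul ε _ hη, ← h]

theorem delbarAddDel_dSplit (p q p' q' : ℤ) (hp : p' = p + 1) (hq : q' = q + 1) (U : Opens M)
    (s : Sec (formPresheaf E M p q) U) :
    onSec (delbarAddDel E M p q p' q' hp hq) U (onSec (dSplit E M p q) U s) = 0 :=
  Subtype.ext (dOn_dOn_add_dOn_dOn _ _ s.2.1)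

theorem dSplit_delbarDel (p q p' q' : ℤ) (hp : p' = p + 1) (hq : q' = q + 1) (U : Opens M)
    (s : Sec (formPresheaf E M p q) U) :
    onSec (dSplit E M p' q') U (onSec (delbarDel E M p q p' q' hp hq) U s) = 0 := by
  refine Prod.ext (Subtype.ext ?_) (Subtype.ext ?_)
  · change dOn (-Complex.I) (dOn Complex.I (dOn (-Complex.I) s.1)) = 0
    rw [dOn_dOn_comm _ _ (isSmooth_dOn _ s.2.1), dOn_dOn_self _ s.2.1, dOn_zero, neg_zero]
  · exact dOn_dOn_self _ (isSmooth_dOn _ s.2.1)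

/-- `∂̄∂∂̄ = -∂̄∂̄∂ = 0` and `∂̄∂∂ = 0`. -/
theorem delbarDel_delbarAddDel (p q p' q' p'' q'' : ℤ) (hp : p' = p + 1) (hq : q' = q + 1)
    (hp' : p'' = p' + 1) (hq' : q'' = q' + 1) (U : Opens M)
    (s : Sec (formPresheafSucc E M p q) U) :
    onSec (delbarDel E M p' q' p'' q'' hp' hq') U
      (onSec (delbarAddDel E M p q p' q' hp hq) U s) = 0 := by
  refine Subtype.ext ?_
  change dOn Complex.I (dOn (-Complex.I) (dOn Complex.I s.1.1 + dOn (-Complex.I) s.2.1)) = 0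
  rw [dOn_add _ (isSmooth_dOn _ s.1.2.1) (isSmooth_dOn _ s.2.2.1), dOn_dOn_self _ s.2.2.1, add_zero,
    dOn_dOn_comm _ _ s.1.2.1, dOn_neg _ (isSmooth_dOn _ (isSmooth_dOn _ s.1.2.1)),
    dOn_dOn_self _ (isSmooth_dOn _ s.1.2.1), neg_zero]

end FormOperators

/-! ### Gluing of forms and multiplication by smooth functions. -/

section FormSheaf

variable {E : Type} [NormedAddCommGroup E] [NormedSpace ℂ E]
  {M : Type u} [TopologicalSpace M] [ChartedSpace E M]

/-- Smoothness is local: on the open set `chartDom E c O` the chart representatives of a form and of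
its restriction to `O` coincide. -/
theorem isSmooth_of_cover {U V W : Opens M} (hU : U ≤ W) (hV : V ≤ W) (hW : W ≤ U ⊔ V)
    {η : ∀ x : W, Fibre E (x : M)} (h : IsSmooth (restrictFun hU η))
    (h' : IsSmooth (restrictFun hV η)) : IsSmooth η := by
  intro c r y hy
  have key {O : Opens M} (hO : O ≤ W) (h : IsSmooth (restrictFun hO η))
      (hyO : (chartAt E c).symm y ∈ O) :
      ContDiffWithinAt ℝ ∞ (chartRep c (extendZero η) r) (chartDom E c W) y := by
    have h1 : ContDiffOn ℝ ∞ (chartRep c (extendZero η) r) (chartDom E c O) :=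
      (h c r).congr fun z hz ↦ (chartRep_congr (extendZero_restrictFun hO η) c r hz).symm
    exact (h1.contDiffAt ((isOpen_chartDom c O).mem_nhds ⟨hy.1, hyO⟩)).contDiffWithinAt
  exact (hW hy.2).elim (key hU h) (key hV h')

variable (E M) in
theorem gluesPairs_formPresheaf (p q : ℤ) : GluesPairs (formPresheaf E M p q) where
  eq_of_res {U V W} hU hV hW s t h₁ h₂ := by
    refine Subtype.ext (funext fun x ↦ ?_)
    rcases hW x.2 with hx | hx
    · exact congrFun (congrArg Subtype.val h₁) ⟨x.1, hx⟩
    · exact congrFun (congrArg Subtype.val h₂) ⟨x.1, hx⟩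
  exists_glue {U V W} hU hV hW s t h := by
    classical
    let η : ∀ x : W, Fibre E (x : M) := fun x ↦
      if hx : x.1 ∈ U then s.1 ⟨x.1, hx⟩ else t.1 ⟨x.1, (hW x.2).resolve_left hx⟩
    have hηU : restrictFun hU η = s.1 := funext fun x ↦ dif_pos x.2
    have hηV : restrictFun hV η = t.1 := by
      funext x
      by_cases hx : x.1 ∈ U
      · exact (dif_pos hx).trans (congrFun (congrArg Subtype.val h) ⟨x.1, hx, x.2⟩)
      · exact dif_neg hx
    have hη : η ∈ forms E p q W := by
      refine ⟨isSmooth_of_cover hU hV hW (hηU ▸ s.2.1) (hηV ▸ t.2.1), fun x ↦ ?_⟩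
      rcases hW x.2 with hx | hx
      · have := s.2.2 ⟨x.1, hx⟩
        rwa [← hηU] at this
      · have := t.2.2 ⟨x.1, hx⟩
        rwa [← hηV] at this
    exact ⟨⟨η, hη⟩, Subtype.ext hηU, Subtype.ext hηV⟩

/-- The product of a function and a form. -/
noncomputable def mulForm (f : M → ℝ) {U : Opens M} (η : ∀ x : U, Fibre E (x : M)) :
    ∀ x : U, Fibre E (x : M) := fun x ↦ (f x : ℂ) • η x

theorem contDiffOn_comp_chart_symm [IsManifold 𝓘(ℝ, E) ∞ M] {f : M → ℝ}
    (hf : ContMDiff 𝓘(ℝ, E) 𝓘(ℝ, ℝ) ∞ f) (c : M) :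
    ContDiffOn ℝ ∞ (f ∘ (chartAt E c).symm) (chartAt E c).target :=
  (hf.comp_contMDiffOn (contMDiffOn_chart_symm (I := 𝓘(ℝ, E)) (x := c))).contDiffOn

theorem mulForm_mem [IsManifold 𝓘(ℝ, E) ∞ M] {f : M → ℝ}
    (hf : ContMDiff 𝓘(ℝ, E) 𝓘(ℝ, ℝ) ∞ f) {p q : ℤ} {U : Opens M}
    {η : ∀ x : U, Fibre E (x : M)} (hη : η ∈ forms E p q U) : mulForm f η ∈ forms E p q U := by
  refine ⟨fun c r ↦ ?_, fun x r ↦ ⟨fun hr ↦ ?_, fun z hz v ↦ ?_⟩⟩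
  · have h1 : ContDiffOn ℝ ∞ (fun y ↦ ((f ((chartAt E c).symm y) : ℝ) : ℂ)) (chartDom E c U) :=
      Complex.ofRealCLM.contDiff.comp_contDiffOn
        ((contDiffOn_comp_chart_symm hf c).mono Set.inter_subset_left)
    refine (h1.smul (hη.1 c r)).congr fun y hy ↦ ?_
    have e1 : extendZero (mulForm f η) ((chartAt E c).symm y) =
        ((f ((chartAt E c).symm y) : ℝ) : ℂ) • extendZero η ((chartAt E c).symm y) := by
      rw [extendZero_apply (mulForm f η) ⟨_, hy.2⟩, extendZero_apply η ⟨_, hy.2⟩]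
      rfl
    rw [chartRep, e1]
    rfl
  · rw [mulForm, Pi.smul_apply, (hη.2 x r).1 hr]
    exact ContinuousAlternatingMap.ext fun v ↦ mul_zero _
  · exact (congrArg (((f x : ℝ) : ℂ) * ·) ((hη.2 x r).2 z hz v)).trans (mul_left_comm _ _ _)

variable (E M) in
/-- Multiplication by a smooth function on `𝓔^{p,q}(U)`. -/
noncomputable def mulSec [IsManifold 𝓘(ℝ, E) ∞ M] (p q : ℤ) (f : C^∞⟮𝓘(ℝ, E), M; 𝓘(ℝ, ℝ), ℝ⟯) (U : Opens M) :
    Sec (formPresheaf E M p q) U →ₗ[ℂ] Sec (formPresheaf E M p q) U where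
  toFun η := ⟨mulForm f η.1, mulForm_mem f.contMDiff η.2⟩
  map_add' _ _ := Subtype.ext <| funext fun x ↦ funext fun _ ↦
    ContinuousAlternatingMap.ext fun _ ↦ mul_add ((f x.1 : ℝ) : ℂ) _ _
  map_smul' a _ := Subtype.ext <| funext fun x ↦ funext fun _ ↦
    ContinuousAlternatingMap.ext fun _ ↦ mul_left_comm ((f x.1 : ℝ) : ℂ) a _

end FormSheaf

end CechForms

namespace CechForms

/-! ### Smooth cut-off functions and surjectivity onto sections over the intersection. -/

section Partition

variable {E : Type} [NormedAddCommGroup E] [NormedSpace ℂ E]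
  {M : Type u} [TopologicalSpace M] [ChartedSpace E M]

variable (E M) in
-- Holomorphic transition maps are real smooth. The cut-off functions live on this underlying real
-- manifold.
theorem isManifold_real [IsManifold 𝓘(ℂ, E) ω M] : IsManifold 𝓘(ℝ, E) ∞ M := by
  refine isManifold_of_contDiffOn _ _ _ fun e e' he he' ↦ ?_
  have h : ContDiffOn ℂ ω (e.symm ≫ₕ e') (e.symm ≫ₕ e').source := by
    have := (contDiffGroupoid ω 𝓘(ℂ, E)).compatible he he'
    rw [contDiffGroupoid, mem_groupoid_of_pregroupoid] at this
    simpa [contDiffPregroupoid] using! this.1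
  simpa using! (h.restrict_scalars ℝ).of_le le_top

/-- A smooth function that vanishes near the complement of `U₀` and equals one near the complement
of `U₁`. -/
theorem exists_smooth_separation [FiniteDimensional ℂ E] [T2Space M] [SecondCountableTopology M]
    [IsManifold 𝓘(ℝ, E) ∞ M] {U₀ U₁ : Opens M} (hU : U₀ ⊔ U₁ = ⊤) :
    ∃ (f : C^∞⟮𝓘(ℝ, E), M; 𝓘(ℝ, ℝ), ℝ⟯) (W₀ W₁ : Opens M), U₀ ⊔ W₀ = ⊤ ∧ U₁ ⊔ W₁ = ⊤ ∧
      (∀ x ∈ W₀, f x = 0) ∧ ∀ x ∈ W₁, f x = 1 := by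
  -- Finite dimension makes `M` locally compact, hence σ-compact by second countability, which is
  -- the setting for smooth bump functions.
  have : FiniteDimensional ℝ E := FiniteDimensional.complexToReal E
  have : LocallyCompactSpace E :=
    have := FiniteDimensional.proper ℝ E
    inferInstance
  have : LocallyCompactSpace M := ChartedSpace.locallyCompactSpace E M
  have hd : Disjoint (U₀ : Set M)ᶜ (U₁ : Set M)ᶜ := by
    rw [Set.disjoint_left]
    intro x h₀ h₁
    exact ((hU.ge : ⊤ ≤ U₀ ⊔ U₁) (Opens.mem_top x)).elim h₀ h₁
  obtain ⟨f, h₀, h₁, -⟩ := exists_contMDiffMap_zero_one_nhds_of_isClosed (n := ⊤) 𝓘(ℝ, E)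
    U₀.isOpen.isClosed_compl U₁.isOpen.isClosed_compl hd
  have cover {U : Opens M} {S : Set M} (h : ∀ᶠ x in 𝓝ˢ (U : Set M)ᶜ, x ∈ S) :
      U ⊔ ⟨interior S, isOpen_interior⟩ = ⊤ := by
    refine top_le_iff.1 fun x _ ↦ ?_
    by_cases hx : x ∈ U
    · exact Or.inl hx
    · exact Or.inr (subset_interior_iff_mem_nhdsSet.2 h hx)
  exact ⟨f, ⟨interior {x | f x = 0}, isOpen_interior⟩, ⟨interior {x | f x = 1}, isOpen_interior⟩,
    cover h₀, cover h₁, fun x hx ↦ interior_subset (s := {x | f x = 0}) hx,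
    fun x hx ↦ interior_subset (s := {x | f x = 1}) hx⟩

variable [FiniteDimensional ℂ E] [T2Space M] [SecondCountableTopology M]

theorem SmoothModule.differenceOnto [IsManifold 𝓘(ℝ, E) ∞ M]
    {F : TopCat.Presheaf (ModuleCat.{u} ℂ) (TopCat.of M)} (S : SmoothModule (M := M) E F)
    (hF : GluesPairs F) {U₀ U₁ : Opens (TopCat.of M)} (hU : U₀ ⊔ U₁ = ⊤) :
    DifferenceOnto F U₀ U₁ := by
  obtain ⟨f, W₀, W₁, h₀, h₁, f₀, f₁⟩ := exists_smooth_separation (E := E) (M := M) hU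
  -- Letting the restrictions of `f` and `1 - f` act gives natural endomorphisms. They vanish where
  -- the function does and sum to the identity because `S.act` is a ring homomorphism.
  let r (g : C^∞⟮𝓘(ℝ, E), M; 𝓘(ℝ, ℝ), ℝ⟯) (U : Opens M) : C^∞⟮𝓘(ℝ, E), U; 𝓘(ℝ, ℝ), ℝ⟯ :=
    ⟨g ∘ Subtype.val, g.contMDiff.comp contMDiff_subtype_val⟩
  refine hF.differenceOnto h₀ h₁ (fun U ↦ S.act U (r f U)) (fun U ↦ S.act U (r (1 - f) U))
    (fun h s ↦ (S.act_res h (r f _) s).symm)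
    (fun h s ↦ (S.act_res h (r (1 - f) _) s).symm)
    (fun U hUW ↦ ?_) (fun U hUW ↦ ?_) (fun U s ↦ ?_)
  · rw [show r f U = 0 from ContMDiffMap.ext fun x ↦ f₀ x.1 (hUW x.2), map_zero]
  · rw [show r (1 - f) U = 0 from ContMDiffMap.ext fun x ↦
      sub_eq_zero.2 (f₁ x.1 (hUW x.2)).symm, map_zero]
  · rw [← LinearMap.add_apply, ← map_add, show r f U + r (1 - f) U = 1 from
      ContMDiffMap.ext fun x ↦ add_sub_cancel (f x.1) 1, map_one, Module.End.one_apply]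

/-- The argument of `SmoothModule.differenceOnto`, with pointwise multiplication `mulSec`. Only
functions defined on all of `M` are needed, so no full `SmoothModule` structure on forms is built.
-/
theorem differenceOnto_formPresheaf [IsManifold 𝓘(ℝ, E) ∞ M] (p q : ℤ) {U₀ U₁ : Opens M}
    (hU : U₀ ⊔ U₁ = ⊤) : DifferenceOnto (formPresheaf E M p q) U₀ U₁ := by
  obtain ⟨f, W₀, W₁, h₀, h₁, f₀, f₁⟩ := exists_smooth_separation (E := E) (M := M) hU
  refine (gluesPairs_formPresheaf E M p q).differenceOnto h₀ h₁ (mulSec E M p q f)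
    (mulSec E M p q (1 - f)) (fun _ _ ↦ rfl) (fun _ _ ↦ rfl) (fun U hUW ↦ ?_) (fun U hUW ↦ ?_)
    (fun U s ↦ ?_)
  · refine LinearMap.ext fun s ↦ Subtype.ext <| funext fun x ↦ funext fun r ↦
      ContinuousAlternatingMap.ext fun v ↦ ?_
    change ((f x.1 : ℝ) : ℂ) * _ = 0
    rw [f₀ x.1 (hUW x.2), Complex.ofReal_zero, zero_mul]
  · refine LinearMap.ext fun s ↦ Subtype.ext <| funext fun x ↦ funext fun r ↦
      ContinuousAlternatingMap.ext fun v ↦ ?_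
    change ((1 - f x.1 : ℝ) : ℂ) * _ = 0
    rw [f₁ x.1 (hUW x.2), sub_self, Complex.ofReal_zero, zero_mul]
  · refine Subtype.ext <| funext fun x ↦ funext fun r ↦ ContinuousAlternatingMap.ext fun v ↦ ?_
    change ((f x.1 : ℝ) : ℂ) * s.1 x r v + ((1 - f x.1 : ℝ) : ℂ) * s.1 x r v = s.1 x r v
    push_cast
    ring

end Partition

end CechForms

/-! ### The three isomorphisms. -/

theorem theorem3p2
    {E : Type} [NormedAddCommGroup E] [NormedSpace ℂ E] [FiniteDimensional ℂ E]
    {M : Type u} [TopologicalSpace M] [T2Space M] [SecondCountableTopology M]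
    [ChartedSpace E M] [IsManifold 𝓘(ℂ, E) ω M]
    (U₀ U₁ : Opens (TopCat.of M)) (hU : U₀ ⊔ U₁ = ⊤) :
    -- every complex of sheaves of `C^∞`-modules, in every degree `r`
    (∀ (K : CochainComplex
          (Sheaf (Opens.grothendieckTopology (TopCat.of M)) (ModuleCat.{u} ℂ)) ℤ)
        (_ : ∀ r : ℤ, SmoothModule (M := M) E (K.X r).obj) (r : ℤ),
      DiagInducesIso (K.d (r - 2) (r - 1)).hom (K.d (r - 1) r).hom (K.d r (r + 1)).hom U₀ U₁) ∧
    -- Bott–Chern cohomology of every type `(p, q)`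
    (∀ p q : ℤ,
      DiagInducesIso (delbarAddDel E M (p - 2) (q - 2) (p - 1) (q - 1))
        (delbarDel E M (p - 1) (q - 1) p q) (dSplit E M p q) U₀ U₁) ∧
    -- Aeppli cohomology of every type `(p, q)`
    (∀ p q : ℤ,
      DiagInducesIso (dSplit E M (p - 1) (q - 1)) (delbarAddDel E M (p - 1) (q - 1) p q)
        (delbarDel E M p q (p + 1) (q + 1)) U₀ U₁) := by
  have : IsManifold 𝓘(ℝ, E) ∞ M := isManifold_real E M
  have glue := gluesPairs_formPresheaf E M
  have onto (p q : ℤ) := differenceOnto_formPresheaf (E := E) (M := M) p q hU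
  refine ⟨fun K S r ↦ ?_, fun p q ↦ ?_, fun p q ↦ ?_⟩
  · have hK (i : ℤ) : GluesPairs (K.X i).obj := gluesPairs_of_isSheaf (K.X i)
    -- `d_comp_d` holds for all indices, so no arithmetic with `r - 2`, `r - 1`, `r`, `r + 1` is
    -- needed.
    have hd (i j k : ℤ) (U : Opens (TopCat.of M)) (s : Sec (K.X i).obj U) :
        onSec (K.d j k).hom U (onSec (K.d i j).hom U s) = 0 :=
      congrArg (fun g ↦ onSec g.hom U s) (K.d_comp_d i j k)
    exact diagInducesIso_of_gluesPairs (hd _ _ _) (hd _ _ _) (hK _) (hK _) (hK _)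
      ((S _).differenceOnto (hK _) hU) ((S _).differenceOnto (hK _) hU) hU
  · exact diagInducesIso_of_gluesPairs (delbarDel_delbarAddDel _ _ _ _ _ _ _ _ _ _)
      (dSplit_delbarDel _ _ _ _ _ _) (glue _ _) (glue _ _) ((glue _ _).prod (glue _ _))
      ((onto _ _).prod (onto _ _)) (onto _ _) hU
  · exact diagInducesIso_of_gluesPairs (delbarAddDel_dSplit _ _ _ _ _ _)
      (delbarDel_delbarAddDel _ _ _ _ _ _ _ _ _ _) ((glue _ _).prod (glue _ _)) (glue _ _)
      (glue _ _) (onto _ _) ((onto _ _).prod (onto _ _)) hU
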